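/- Let $a<b$, let $\bar\mu=\frac{a+b}{2}$ and $\sigma=\frac{b-a}{2\sqrt3}$ be the mean and standard deviation of the uniform law on $[a,b]$, and let $I_\xi=[-\sqrt3,\sqrt3]$. Let $f:\mathbb R^n\times[a,b]\to\mathbb R^n$ be continuous and differentiable in its first argument, with $D_uf$ continuous on $\mathbb R^n\times[a,b]$. Let $\bar u\in C(I_\xi;\mathbb R^n)$ be a solution branch, i.e. $f(\bar u(z),\bar\mu+\sigma z)=0$ for all $z\in I_\xi$. Assume that $\bar u\in H^s(I_\xi;\mathbb R^n)$ for a real $s>1$, and that the Jacobian is uniformly positive definite along the branch: there is $\lambda_{\min}>0$ with $$\langle D_uf(\bar u(z),\bar\mu+\sigma z)w,w\rangle\ge\lambda_{\min}\|w\|^2\qquad\text{for all } z\in I_\xi,\ w\in\mathbb R^n$$ (or uniformly negative definite: the left side is $\le-\lambda_{\min}\|w\|^2$ for all such $z,w$). Let $\Pi_N^n$ be the space of $\mathbb R^n$-valued polynomials of degree at most $N$ on $I_\xi$, and let $u_{LS,N}\in\Pi_N^n$ be the best approximation of $\bar u$ in $L^2(I_\xi;\mathbb R^n)$. A Galerkin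 solution of degree $N$ is a $p\in\Pi_N^n$ with $$\int_{I_\xi}\langle f(p(z),\bar\mu+\sigma z),v(z)\rangle\,dz=0\qquad\text{for all } v\in\Pi_N^n .$$ Then there are $\rho>0$ and $N_{\mathrm{conv}}\in\mathbb N$ such that for every $N\ge N_{\mathrm{conv}}$ there is exactly one Galerkin solution $u_N$ of degree $N$ with $\|u_N(z)-u_{LS,N}(z)\|<\rho$ for all $z\in I_\xi$. These local solutions converge to $\bar u$ uniformly on $I_\xi$, and successive approximations satisfy $$\|u_N-u_{N+1}\|_{L^2(I_\xi;\mathbb R^n)}=\mathcal O(N^{-s})\qquad(N\to\infty).$$ The same estimate holds for every sequence $(u_N)$ such that $u_N$ is a Galerkin solution of degree $N$ for all large $N$ and $u_N\to\bar u$ uniformly on $I_\xi$. -/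

import Mathlib

open MeasureTheory Set Filter Topology Asymptotics
open scoped ContDiff

namespace PCEGalerkin

/-- The state space `ℝⁿ` with its Euclidean norm. -/
abbrev State (n : ℕ) := EuclideanSpace ℝ (Fin n)

/-- The mean of a random variable that is uniformly distributed on `[a, b]`. -/
noncomputable def paramMean (a b : ℝ) : ℝ := (a + b) / 2

/-- The standard deviation of a random variable that is uniformly distributed on `[a, b]`. -/
noncomputable def paramStd (a b : ℝ) : ℝ := (b - a) / (2 * Real.sqrt 3)

/-- The interval `[-√3, √3]` of the normalized parameter `ξ = (μ - mean) / std`. -/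
noncomputable def xiInterval : Set ℝ := Icc (-Real.sqrt 3) (Real.sqrt 3)

/-- The physical parameter `mean + std * z` that belongs to the normalized parameter `z`. -/
noncomputable def param (a b z : ℝ) : ℝ := paramMean a b + paramStd a b * z

/-- The `L²` norm over `[-√3, √3]` of a curve in `ℝⁿ`. -/
noncomputable def l2Norm {n : ℕ} (v : ℝ → State n) : ℝ :=
  Real.sqrt (∫ z in xiInterval, ‖v z‖ ^ 2)

/-- `v` is a weak derivative of `u` on the open interval `(-√3, √3)`. -/
def HasWeakDeriv {n : ℕ} (u v : ℝ → State n) : Prop :=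
  ∀ φ : ℝ → ℝ, ContDiff ℝ ∞ φ → HasCompactSupport φ →
    tsupport φ ⊆ Ioo (-Real.sqrt 3) (Real.sqrt 3) →
    ∫ z in xiInterval, deriv φ z • u z = -∫ z in xiInterval, φ z • v z

/-- The square of the Gagliardo seminorm of order `θ ∈ (0, 1)` on `(-√3, √3)`:
`∬ ‖v x - v y‖² / |x - y| ^ (1 + 2 θ) dx dy`. -/
noncomputable def gagliardoSq {n : ℕ} (θ : ℝ) (v : ℝ → State n) : ENNReal :=
  ∫⁻ x in xiInterval, ∫⁻ y in xiInterval,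
    ‖v x - v y‖ₑ ^ 2 / ENNReal.ofReal (|x - y| ^ (1 + 2 * θ))

/-- Membership in the Sobolev space `H^s((-√3, √3); ℝⁿ)` for real `s ≥ 0`: with `m = ⌊s⌋`, the weak
derivatives of orders `0, …, m` exist and are in `L²`, and, when `s` is not an integer, the weak
derivative of order `m` has a finite Gagliardo seminorm of order `s - m`. -/
def MemSobolev {n : ℕ} (s : ℝ) (u : ℝ → State n) : Prop :=
  ∃ D : ℕ → ℝ → State n,
    D 0 =ᵐ[volume.restrict xiInterval] u ∧
    (∀ k ≤ ⌊s⌋₊, MemLp (D k) 2 (volume.restrict xiInterval)) ∧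
    (∀ k < ⌊s⌋₊, HasWeakDeriv (D k) (D (k + 1))) ∧
    (s ≠ ⌊s⌋₊ → gagliardoSq (s - ⌊s⌋₊) (D ⌊s⌋₊) < ⊤)

/-- Vectors of `n` real polynomials of degree at most `N`: the span, in each component, of the
orthogonal (scaled Legendre) polynomials `Φ₀, …, Φ_N`, where `Φ_k` has degree `k`. -/
def polySpace (n N : ℕ) : Set (Fin n → Polynomial ℝ) :=
  {p | ∀ i, (p i).natDegree ≤ N}

/-- The curve in `ℝⁿ` given by a vector of polynomials. -/
noncomputable def polyCurve {n : ℕ} (p : Fin n → Polynomial ℝ) (z : ℝ) : State n :=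
  WithLp.toLp 2 fun i => (p i).eval z

/-- `p` is the best approximation of `u` in `L²` among the polynomial curves of degree at most
`N` (the least-squares approximation of degree `N`). -/
def IsLeastSquares {n : ℕ} (N : ℕ) (u : ℝ → State n) (p : Fin n → Polynomial ℝ) : Prop :=
  p ∈ polySpace n N ∧ ∀ q ∈ polySpace n N,
    l2Norm (fun z => u z - polyCurve p z) ≤ l2Norm (fun z => u z - polyCurve q z)

/-- `p` solves the Galerkin system of degree `N`: it is a polynomial curve of degree at most `N`
whose residual `z ↦ f (p z) (mean + std * z)` is orthogonal in `L²` to all such curves. -/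
def IsGalerkinSolution {n : ℕ} (f : State n → ℝ → State n) (a b : ℝ) (N : ℕ)
    (p : Fin n → Polynomial ℝ) : Prop :=
  p ∈ polySpace n N ∧ ∀ v ∈ polySpace n N,
    ∫ z in xiInterval, inner ℝ (f (polyCurve p z) (param a b z)) (polyCurve v z) = 0

/-- `p` is a Galerkin solution of degree `N` at uniform distance less than `ρ` from a polynomial
curve `q`. -/
def IsGalerkinSolutionNear {n : ℕ} (f : State n → ℝ → State n) (a b : ℝ) (N : ℕ) (ρ : ℝ)
    (q p : Fin n → Polynomial ℝ) : Prop :=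
  IsGalerkinSolution f a b N p ∧ ∀ z ∈ xiInterval, ‖polyCurve p z - polyCurve q z‖ < ρ

/-- The Jacobian matrix (as a linear map) of `f` in its first argument. -/
noncomputable def jac {n : ℕ} (f : State n → ℝ → State n) (u : State n) (μ : ℝ) :
    State n →L[ℝ] State n :=
  fderiv ℝ (fun w => f w μ) u

/-- The `L²` distances of successive terms of `u` are `O(N^(-s))` as `N → ∞`. -/
def SuccessiveRate {n : ℕ} (s : ℝ) (u : ℕ → Fin n → Polynomial ℝ) : Prop :=
  (fun N : ℕ => l2Norm fun z => polyCurve (u N) z - polyCurve (u (N + 1)) z)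
    =O[atTop] fun N : ℕ => (N : ℝ) ^ (-s)

end PCEGalerkin

namespace PCEGalerkin

open Polynomial

/-! The proof joins an approximation theorem to a monotonicity argument. If the best L²
approximation error of the branch is O(N^(-s)), the inverse inequality ‖p‖_∞ ≤ C (N+1) ‖p‖_{L²}
(`exists_norm_polyCurve_le`) and a dyadic telescoping turn it into the uniform rate N^(1-s)
(`exists_uniform_rate`), which tends to zero because s > 1. By compactness, definiteness of the
Jacobian along the branch extends to a uniform tube on which f is Lipschitz and strongly monotone
(`exists_isMonotoneTube`), and the least-squares curves eventually lie in this tube.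

An L² ball of radius comparable to N^(-s) around the least-squares curve then lies in the tube,
again by the inverse inequality. A damped projected fixed-point iteration contracts this ball and
yields a Galerkin solution (`exists_galerkin_of_strongly_monotone`). Testing with differences gives
uniqueness (`IsGalerkinSolution.eq_of_tube`) and a Céa estimate
(`IsGalerkinSolution.l2Norm_sub_le`), and the triangle inequality gives the rate for successive
terms. The negative definite case follows by passing to -f.

The L² rate is built from one first-order estimate. Under x = R cos t, Chebyshev expansions become
cosine series, and truncation gains a factor 1/(N+1) against the derivative
(`exists_approx_of_polynomial`). Subtracting a primitive of an approximant of the derivative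
iterates this (`HasPolynomialRate.of_weakDeriv`). The fractional part of s is handled by mollifying
at scale 1/(N+1) (`HasPolynomialRate.of_gagliardo`). -/

/-! ### Trigonometric orthogonality and Chebyshev expansions. -/

lemma integral_cos_int_mul (m : ℤ) :
    ∫ t in (0:ℝ)..Real.pi, Real.cos (m * t) = if m = 0 then Real.pi else 0 := by
  split_ifs with h
  · simp [h]
  · have hm : (m : ℝ) ≠ 0 := by exact_mod_cast h
    rw [intervalIntegral.integral_comp_mul_left _ hm]
    simp [Real.sin_int_mul_pi]

lemma integral_cos_mul_cos (k l : ℕ) :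
    ∫ t in (0:ℝ)..Real.pi, Real.cos (k * t) * Real.cos (l * t) =
      if k = l then (if k = 0 then Real.pi else Real.pi / 2) else 0 := by
  have h : ∀ t : ℝ, Real.cos (k * t) * Real.cos (l * t) =
      (Real.cos (((k : ℤ) - l : ℤ) * t) + Real.cos (((k : ℤ) + l : ℤ) * t)) / 2 := by
    intro t
    push_cast
    rw [sub_mul, add_mul, Real.cos_sub, Real.cos_add]
    ring
  simp_rw [h]
  rw [intervalIntegral.integral_div, intervalIntegral.integral_add, integral_cos_int_mul,
    integral_cos_int_mul]
  · split_ifs <;> first | (exfalso; omega) | ring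
  all_goals exact Continuous.intervalIntegrable (by fun_prop) _ _

lemma integral_sin_mul_sin (k l : ℕ) :
    ∫ t in (0:ℝ)..Real.pi, Real.sin (k * t) * Real.sin (l * t) =
      if k = l then (if k = 0 then 0 else Real.pi / 2) else 0 := by
  have h : ∀ t : ℝ, Real.sin (k * t) * Real.sin (l * t) =
      (Real.cos (((k : ℤ) - l : ℤ) * t) - Real.cos (((k : ℤ) + l : ℤ) * t)) / 2 := by
    intro t
    push_cast
    rw [sub_mul, add_mul, Real.cos_sub, Real.cos_add]
    ring
  simp_rw [h]
  rw [intervalIntegral.integral_div, intervalIntegral.integral_sub, integral_cos_int_mul,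
    integral_cos_int_mul]
  · split_ifs <;> first | (exfalso; omega) | ring
  all_goals exact Continuous.intervalIntegrable (by fun_prop) _ _

/-- Parseval for a finite orthogonal system, in a form that serves cosines and sines alike. -/
lemma integral_sum_sq_of_orthogonal (e : ℕ → ℝ → ℝ) (he : ∀ k, Continuous (e k)) (γ : ℕ → ℝ)
    {x y : ℝ} (horth : ∀ k l, ∫ t in x..y, e k t * e l t = if k = l then γ k else 0)
    (s : Finset ℕ) (a : ℕ → ℝ) :
    ∫ t in x..y, (∑ k ∈ s, a k * e k t) ^ 2 = ∑ k ∈ s, γ k * a k ^ 2 := by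
  have h : ∀ t, (∑ k ∈ s, a k * e k t) ^ 2 =
      ∑ k ∈ s, ∑ l ∈ s, (a k * a l) * (e k t * e l t) := by
    intro t
    rw [sq, Finset.sum_mul_sum]
    refine Finset.sum_congr rfl fun k _ => Finset.sum_congr rfl fun l _ => by ring
  simp_rw [h]
  rw [intervalIntegral.integral_finsetSum]
  · refine Finset.sum_congr rfl fun k hk => ?_
    rw [intervalIntegral.integral_finsetSum]
    · simp_rw [intervalIntegral.integral_const_mul, horth, mul_ite, mul_zero]
      rw [Finset.sum_ite_eq, if_pos hk]
      ring
    · intro l _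
      exact Continuous.intervalIntegrable (by fun_prop) _ _
  · intro k _
    exact Continuous.intervalIntegrable (by fun_prop) _ _

lemma integral_cos_sum_sq (s : Finset ℕ) (a : ℕ → ℝ) :
    ∫ t in (0:ℝ)..Real.pi, (∑ k ∈ s, a k * Real.cos (k * t)) ^ 2 =
      ∑ k ∈ s, (if k = 0 then Real.pi else Real.pi / 2) * a k ^ 2 :=
  integral_sum_sq_of_orthogonal (fun k t => Real.cos (k * t)) (fun k => by fun_prop) _
    integral_cos_mul_cos s a

lemma integral_sin_sum_sq (s : Finset ℕ) (a : ℕ → ℝ) :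
    ∫ t in (0:ℝ)..Real.pi, (∑ k ∈ s, a k * Real.sin (k * t)) ^ 2 =
      ∑ k ∈ s, (if k = 0 then 0 else Real.pi / 2) * a k ^ 2 :=
  integral_sum_sq_of_orthogonal (fun k t => Real.sin (k * t)) (fun k => by fun_prop) _
    integral_sin_mul_sin s a

/-- Every polynomial is a combination of Chebyshev polynomials. -/
lemma exists_chebyshev_expansion (N : ℕ) : ∀ p : ℝ[X], p.natDegree ≤ N →
    ∃ a : ℕ → ℝ, p = ∑ k ∈ Finset.range (N + 1), C (a k) * Chebyshev.T ℝ k := by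
  induction N with
  | zero =>
    intro p hp
    refine ⟨fun _ => p.coeff 0, ?_⟩
    simpa using eq_C_of_natDegree_le_zero hp
  | succ N ih =>
    intro p hp
    set T := Chebyshev.T ℝ (N + 1 : ℕ) with hT
    have hdeg : T.natDegree = N + 1 := by rw [hT, Chebyshev.natDegree_T, Int.natAbs_natCast]
    have hlead : T.coeff (N + 1) ≠ 0 := by
      rw [← hdeg]
      exact leadingCoeff_ne_zero.2 (Chebyshev.T_ne_zero ℝ _)
    -- This multiple of T cancels the coefficient of degree N + 1, so the induction hypothesis
    -- applies to the difference.
    set c := p.coeff (N + 1) / T.coeff (N + 1) with hc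
    obtain ⟨a, ha⟩ := ih (p - C c * T) (by
      rw [natDegree_le_iff_coeff_eq_zero]
      intro k hk
      rw [coeff_sub, coeff_C_mul]
      rcases (Nat.succ_le_of_lt hk).eq_or_lt with h | h
      · rw [← h, hc]
        simp only [Nat.succ_eq_add_one]
        field_simp
        ring
      · rw [coeff_eq_zero_of_natDegree_lt (lt_of_le_of_lt hp h),
          coeff_eq_zero_of_natDegree_lt (by rw [hdeg]; exact h)]
        simp)
    refine ⟨fun k => if k = N + 1 then c else a k, ?_⟩
    simp only [Finset.sum_range_succ _ (N + 1), if_true]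
    have : ∑ k ∈ Finset.range (N + 1), C (if k = N + 1 then c else a k) * Chebyshev.T ℝ k =
        ∑ k ∈ Finset.range (N + 1), C (a k) * Chebyshev.T ℝ k :=
      Finset.sum_congr rfl fun k hk => by
        rw [if_neg]; exact (Finset.mem_range.1 hk).ne
    rw [this, ← ha]
    simp [hT]

lemma natDegree_comp_C_mul_X_le (p : ℝ[X]) (c : ℝ) :
    (p.comp (C c * X)).natDegree ≤ p.natDegree :=
  natDegree_comp_le.trans ((Nat.mul_le_mul_left _ (natDegree_C_mul_le _ _)).trans (by simp))

/-- Comes from T_k(cos t) = cos(kt), after rescaling [-R, R] to [-1, 1]. -/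
lemma exists_cos_expansion {R : ℝ} (N : ℕ) (p : ℝ[X]) (hp : p.natDegree ≤ N) :
    ∃ a : ℕ → ℝ, ∀ t, p.eval (R * Real.cos t) =
      ∑ k ∈ Finset.range (N + 1), a k * Real.cos (k * t) := by
  obtain ⟨a, ha⟩ := exists_chebyshev_expansion N (p.comp (C R * X))
    ((natDegree_comp_C_mul_X_le p R).trans hp)
  refine ⟨a, fun t => ?_⟩
  have h := congrArg (eval (Real.cos t)) ha
  rw [eval_comp] at h
  simp only [eval_mul, eval_C, eval_X, eval_finsetSum] at h
  rw [h]
  refine Finset.sum_congr rfl fun k _ => ?_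
  have := Chebyshev.T_real_cos t (k : ℤ)
  push_cast at this
  rw [this]

/-! ### The inverse inequality. -/

lemma integral_comp_cos_mul_sin {R : ℝ} {g : ℝ → ℝ} (hg : Continuous g) :
    ∫ x in (-R)..R, g x = R * ∫ t in (0:ℝ)..Real.pi, g (R * Real.cos t) * Real.sin t := by
  have h := intervalIntegral.integral_comp_mul_deriv (a := 0) (b := Real.pi)
    (f := fun t => R * Real.cos t) (f' := fun t => R * -Real.sin t) (g := g)
    (fun t _ => (Real.hasDerivAt_cos t).const_mul R) (by fun_prop) hg
  simp only [Real.cos_zero, Real.cos_pi, mul_one, mul_neg, Function.comp_apply] at h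
  rw [intervalIntegral.integral_symm, ← h, intervalIntegral.integral_neg, neg_neg,
    ← intervalIntegral.integral_const_mul]
  congr 1; ext t; ring

/-- The inverse inequality between the sup norm and the `L²` norm of a polynomial. -/
theorem eval_sq_le_integral_sq {R : ℝ} (hR : 0 < R) {N : ℕ} {p : ℝ[X]} (hp : p.natDegree ≤ N)
    {x : ℝ} (hx : x ∈ Icc (-R) R) :
    p.eval x ^ 2 ≤ 16 / (Real.pi * R) * ((N : ℝ) + 1) ^ 2 * ∫ y in (-R)..R, p.eval y ^ 2 := by
  obtain ⟨a, ha⟩ := exists_cos_expansion (R := R) N p hp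
  have hpi := Real.pi_pos
  set G : ℝ → ℝ := fun t => p.eval (R * Real.cos t) ^ 2 with hG
  have hGc : Continuous G := by
    have := p.continuous
    fun_prop
  set A := ∫ t in (0:ℝ)..Real.pi, G t with hA
  set S := ∑ k ∈ Finset.range (N + 1), a k ^ 2 with hS
  have hN : (0 : ℝ) < N + 1 := by positivity
  have hSA : Real.pi / 2 * S ≤ A := by
    have : A = ∑ k ∈ Finset.range (N + 1), (if k = 0 then Real.pi else Real.pi / 2) * a k ^ 2 := by
      rw [← integral_cos_sum_sq, hA, hG]
      simp_rw [ha]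
    rw [this, hS, Finset.mul_sum]
    refine Finset.sum_le_sum fun k _ => mul_le_mul_of_nonneg_right ?_ (sq_nonneg _)
    split_ifs <;> linarith
  -- Cauchy–Schwarz over the N + 1 coefficients, followed by Parseval. It remains to pass from the
  -- unweighted A to the integral with weight sin t.
  have hsup : ∀ t, G t ≤ 2 / Real.pi * (N + 1) * A := by
    intro t
    have h1 : G t ≤ (N + 1) * S := by
      rw [hG]
      simp only [ha]
      refine (sq_sum_le_card_mul_sum_sq).trans ?_
      rw [Finset.card_range]
      push_cast
      refine mul_le_mul_of_nonneg_left (Finset.sum_le_sum fun k _ => ?_) hN.le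
      rw [mul_pow]
      exact mul_le_of_le_one_right (sq_nonneg _) (Real.cos_sq_le_one _)
    have h2 : S ≤ 2 / Real.pi * A := by
      rw [div_mul_eq_mul_div, le_div_iff₀ hpi]; linarith
    calc G t ≤ (N + 1) * S := h1
      _ ≤ (N + 1) * (2 / Real.pi * A) := by gcongr
      _ = _ := by ring
  -- By the sup bound, an interval of this length carries at most A / 4. Cutting one off at each end
  -- leaves A / 2 in the middle, where sin t ≥ 2ε/π = 1 / (4(N + 1)).
  set ε := Real.pi / (8 * (N + 1)) with hε
  have hε0 : 0 < ε := by positivity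
  have hε1 : ε ≤ Real.pi / 8 := by
    rw [hε]; gcongr
    have : (0 : ℝ) ≤ N := by positivity
    linarith
  have hGi : ∀ u v, IntervalIntegrable G volume u v := fun u v => hGc.intervalIntegrable u v
  have hend : ∀ u, ∫ t in u..(u + ε), G t ≤ A / 4 := by
    intro u
    calc ∫ t in u..(u + ε), G t ≤ ∫ t in u..(u + ε), 2 / Real.pi * (N + 1) * A :=
          intervalIntegral.integral_mono_on (by linarith) (hGi _ _) (by simp) fun t _ => hsup t
      _ = A / 4 := by
          rw [intervalIntegral.integral_const, smul_eq_mul, hε]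
          field_simp
          ring
  have hmid : A / 2 ≤ ∫ t in ε..(Real.pi - ε), G t := by
    have h1 := hend 0
    have h2 := hend (Real.pi - ε)
    rw [zero_add] at h1
    rw [sub_add_cancel] at h2
    have h3 : A = (∫ t in (0:ℝ)..ε, G t) + (∫ t in ε..(Real.pi - ε), G t) +
        ∫ t in (Real.pi - ε)..Real.pi, G t := by
      rw [intervalIntegral.integral_add_adjacent_intervals (hGi _ _) (hGi _ _),
        intervalIntegral.integral_add_adjacent_intervals (hGi _ _) (hGi _ _)]
    linarith
  have hGs : ∀ u v, IntervalIntegrable (fun t => G t * Real.sin t) volume u v :=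
    fun u v => Continuous.intervalIntegrable (by fun_prop) u v
  have hsin : ∀ t ∈ Icc ε (Real.pi - ε), 1 / (4 * ((N : ℝ) + 1)) ≤ Real.sin t := by
    have key : ∀ t, ε ≤ t → t ≤ Real.pi / 2 → 1 / (4 * ((N : ℝ) + 1)) ≤ Real.sin t := by
      intro t h1 h2
      refine le_trans ?_ (Real.mul_le_sin (by linarith) h2)
      calc 1 / (4 * ((N : ℝ) + 1)) = 2 / Real.pi * ε := by rw [hε]; field_simp; norm_num
        _ ≤ 2 / Real.pi * t := by gcongr
    intro t ht
    rcases le_total t (Real.pi / 2) with h | h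
    · exact key t ht.1 h
    · rw [← Real.sin_pi_sub]
      exact key _ (by linarith [ht.2]) (by linarith)
  set B := ∫ t in (0:ℝ)..Real.pi, G t * Real.sin t with hB
  have hAB : A ≤ 8 * (N + 1) * B := by
    have h1 : 1 / (4 * ((N : ℝ) + 1)) * ∫ t in ε..(Real.pi - ε), G t ≤
        ∫ t in ε..(Real.pi - ε), G t * Real.sin t := by
      rw [← intervalIntegral.integral_const_mul]
      refine intervalIntegral.integral_mono_on (by linarith) ((hGi _ _).const_mul _) (hGs _ _) ?_
      intro t ht
      rw [mul_comm]
      exact mul_le_mul_of_nonneg_left (hsin t ht) (sq_nonneg _)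
    have h2 : ∫ t in ε..(Real.pi - ε), G t * Real.sin t ≤ B := by
      refine intervalIntegral.integral_mono_interval hε0.le (by linarith) (by linarith) ?_ (hGs _ _)
      refine (ae_restrict_mem measurableSet_Ioc).mono fun t ht => ?_
      exact mul_nonneg (sq_nonneg _) (Real.sin_nonneg_of_nonneg_of_le_pi ht.1.le ht.2)
    have h3 : 1 / (4 * ((N : ℝ) + 1)) * (A / 2) ≤ B :=
      (mul_le_mul_of_nonneg_left hmid (by positivity)).trans (h1.trans h2)
    calc A = 8 * (N + 1) * (1 / (4 * ((N : ℝ) + 1)) * (A / 2)) := by field_simp; ring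
      _ ≤ _ := by gcongr
  have hxR : x = R * Real.cos (Real.arccos (x / R)) := by
    rw [Real.cos_arccos]
    · field_simp
    · rw [le_div_iff₀ hR]; linarith [hx.1]
    · rw [div_le_iff₀ hR]; linarith [hx.2]
  have hI : ∫ y in (-R)..R, p.eval y ^ 2 = R * B := by
    have := p.continuous
    rw [integral_comp_cos_mul_sin (by fun_prop)]
  calc p.eval x ^ 2 = G (Real.arccos (x / R)) := by rw [hG]; simp only [← hxR]
    _ ≤ 2 / Real.pi * (N + 1) * A := hsup _
    _ ≤ 2 / Real.pi * (N + 1) * (8 * (N + 1) * B) := by gcongr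
    _ = _ := by rw [hI]; field_simp; ring

/-! ### The first-order approximation estimate for polynomials. -/

/-- A polynomial is approximated in `L²` by polynomials of degree at most `N` up to `R / (N + 1)`
times the norm of its derivative. -/
theorem exists_approx_of_polynomial {R : ℝ} (hR : 0 < R) (N : ℕ) (p : ℝ[X]) :
    ∃ q : ℝ[X], q.natDegree ≤ N ∧ ∫ x in (-R)..R, (p.eval x - q.eval x) ^ 2 ≤
      (R / ((N : ℝ) + 1)) ^ 2 * ∫ x in (-R)..R, (derivative p).eval x ^ 2 := by
  have hpi := Real.pi_pos
  -- The maximum with N makes the truncated index set a subset of the full one even when p has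
  -- degree below N.
  set M := max p.natDegree N
  obtain ⟨a, ha⟩ := exists_cos_expansion (R := R) M p (le_max_left _ _)
  set s := Finset.range (M + 1)
  set s₁ := Finset.range (N + 1)
  have hss : s₁ ⊆ s := Finset.range_mono (by have := le_max_right p.natDegree N; omega)
  -- The approximant is the Chebyshev expansion of p, truncated after degree N.
  set q : ℝ[X] := (∑ k ∈ s₁, C (a k) * Chebyshev.T ℝ k).comp (C (1 / R) * X) with hq
  have hqe : ∀ t, q.eval (R * Real.cos t) = ∑ k ∈ s₁, a k * Real.cos (k * t) := by
    intro t
    rw [hq, eval_comp]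
    simp only [eval_mul, eval_C, eval_X, eval_finsetSum]
    refine Finset.sum_congr rfl fun k _ => ?_
    have := Chebyshev.T_real_cos t (k : ℤ)
    push_cast at this
    rw [← this]
    congr 2
    field_simp
  refine ⟨q, ?_, ?_⟩
  · refine (natDegree_comp_C_mul_X_le _ _).trans (natDegree_sum_le_of_forall_le s₁ _ ?_)
    intro k hk
    refine (natDegree_C_mul_le _ _).trans ?_
    rw [Chebyshev.natDegree_T]
    simpa using Nat.lt_succ_iff.1 (Finset.mem_range.1 hk)
  have hpc := p.continuous
  have hqc := q.continuous
  have hdc := (derivative p).continuous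
  have hN : (0 : ℝ) < N + 1 := by positivity
  rw [integral_comp_cos_mul_sin (by fun_prop), integral_comp_cos_mul_sin (by fun_prop)]
  -- Differentiating the cosine expansion in t multiplies the k-th coefficient by k; the chain rule
  -- supplies the factor R sin t.
  have hderiv : ∀ t, R * Real.sin t * (derivative p).eval (R * Real.cos t) =
      ∑ k ∈ s, (k * a k) * Real.sin (k * t) := by
    intro t
    have h1 : HasDerivAt (fun t => p.eval (R * Real.cos t))
        ((derivative p).eval (R * Real.cos t) * (R * -Real.sin t)) t :=
      (p.hasDerivAt _).comp t ((Real.hasDerivAt_cos t).const_mul R)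
    have h2 : HasDerivAt (fun t => ∑ k ∈ s, a k * Real.cos (k * t))
        (∑ k ∈ s, a k * (-Real.sin (k * t) * (k * 1))) t :=
      HasDerivAt.fun_sum fun k _ => (((hasDerivAt_id t).const_mul (k : ℝ)).cos).const_mul _
    have h3 : (fun t => p.eval (R * Real.cos t)) = fun t => ∑ k ∈ s, a k * Real.cos (k * t) :=
      funext ha
    rw [h3] at h1
    have h4 := h1.unique h2
    calc _ = -((derivative p).eval (R * Real.cos t) * (R * -Real.sin t)) := by ring
      _ = _ := by
        rw [h4, ← Finset.sum_neg_distrib]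
        exact Finset.sum_congr rfl fun k _ => by ring
  -- The weight sin t ≤ 1 is dropped so that the unweighted Parseval identity applies.
  have h1 : ∫ t in (0:ℝ)..Real.pi, (p.eval (R * Real.cos t) - q.eval (R * Real.cos t)) ^ 2 *
      Real.sin t ≤ ∑ k ∈ s \ s₁, Real.pi / 2 * a k ^ 2 := by
    calc _ ≤ ∫ t in (0:ℝ)..Real.pi, (∑ k ∈ s \ s₁, a k * Real.cos (k * t)) ^ 2 := by
          refine intervalIntegral.integral_mono_on hpi.le
            (Continuous.intervalIntegrable (by fun_prop) _ _)
            (Continuous.intervalIntegrable (by fun_prop) _ _) fun t _ => ?_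
          have : p.eval (R * Real.cos t) - q.eval (R * Real.cos t) =
              ∑ k ∈ s \ s₁, a k * Real.cos (k * t) := by
            rw [ha, hqe, ← Finset.sum_sdiff hss]; ring
          rw [this]
          exact mul_le_of_le_one_right (sq_nonneg _) (Real.sin_le_one _)
      _ = _ := by
          rw [integral_cos_sum_sq]
          refine Finset.sum_congr rfl fun k hk => ?_
          rw [if_neg]
          rintro rfl
          simp [s₁] at hk
  have h2 : ((N : ℝ) + 1) ^ 2 * ∑ k ∈ s \ s₁, Real.pi / 2 * a k ^ 2 ≤
      ∫ t in (0:ℝ)..Real.pi, (∑ k ∈ s, (k * a k) * Real.sin (k * t)) ^ 2 := by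
    rw [integral_sin_sum_sq, Finset.mul_sum]
    calc _ ≤ ∑ k ∈ s \ s₁, (if k = 0 then 0 else Real.pi / 2) * (k * a k) ^ 2 := by
          refine Finset.sum_le_sum fun k hk => ?_
          have hk' : N + 1 ≤ k := by
            simp only [s₁, Finset.mem_sdiff, Finset.mem_range, not_lt] at hk
            exact hk.2
          rw [if_neg (by omega)]
          have : ((N : ℝ) + 1) ^ 2 ≤ (k : ℝ) ^ 2 := by
            gcongr
            exact_mod_cast hk'
          calc _ = Real.pi / 2 * (((N : ℝ) + 1) ^ 2 * a k ^ 2) := by ring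
            _ ≤ Real.pi / 2 * ((k : ℝ) ^ 2 * a k ^ 2) := by gcongr
            _ = _ := by ring
      _ ≤ _ := by
          refine Finset.sum_le_sum_of_subset_of_nonneg Finset.sdiff_subset fun k _ _ => ?_
          refine mul_nonneg ?_ (sq_nonneg _)
          split_ifs <;> linarith
  -- Here the chain rule gives sin² t ≤ sin t, which restores the weight of dx.
  have h3 : ∫ t in (0:ℝ)..Real.pi, (∑ k ∈ s, (k * a k) * Real.sin (k * t)) ^ 2 ≤
      R ^ 2 * ∫ t in (0:ℝ)..Real.pi, (derivative p).eval (R * Real.cos t) ^ 2 * Real.sin t := by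
    rw [← intervalIntegral.integral_const_mul]
    refine intervalIntegral.integral_mono_on hpi.le
      (Continuous.intervalIntegrable (by fun_prop) _ _)
      (Continuous.intervalIntegrable (by fun_prop) _ _) fun t ht => ?_
    have hs0 := Real.sin_nonneg_of_nonneg_of_le_pi ht.1 ht.2
    rw [← hderiv, mul_pow, mul_pow, mul_assoc]
    have : Real.sin t ^ 2 ≤ Real.sin t := by nlinarith [Real.sin_le_one t]
    calc _ ≤ R ^ 2 * (Real.sin t * (derivative p).eval (R * Real.cos t) ^ 2) := by gcongr
      _ = _ := by ring
  set J := ∫ t in (0:ℝ)..Real.pi, (derivative p).eval (R * Real.cos t) ^ 2 * Real.sin t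
  set Q := ∑ k ∈ s \ s₁, Real.pi / 2 * a k ^ 2
  have h4 : Q ≤ R ^ 2 * J / ((N : ℝ) + 1) ^ 2 := by
    rw [le_div_iff₀ (by positivity)]
    linarith
  calc _ ≤ R * (R ^ 2 * J / ((N : ℝ) + 1) ^ 2) := by
        gcongr
        exact h1.trans h4
    _ = _ := by field_simp

/-! ### L² tools on an interval, and the first-order estimate for primitives of L² functions. -/

lemma eLpNorm_two_eq {α E : Type*} [MeasurableSpace α] [NormedAddCommGroup E] {μ : Measure α}
    {F : α → E} (hF : MemLp F 2 μ) :
    eLpNorm F 2 μ = ENNReal.ofReal (Real.sqrt (∫ x, ‖F x‖ ^ 2 ∂μ)) := by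
  rw [hF.eLpNorm_eq_integral_rpow_norm (by norm_num) (by norm_num), Real.sqrt_eq_rpow]
  norm_num

lemma eLpNorm_two_sq {α E : Type*} [MeasurableSpace α] [NormedAddCommGroup E] {μ : Measure α}
    (F : α → E) : eLpNorm F 2 μ ^ 2 = ∫⁻ x, ‖F x‖ₑ ^ 2 ∂μ := by
  have := eLpNorm_nnreal_pow_eq_lintegral (μ := μ) (f := F) (p := 2) (by norm_num)
  simpa using this

/-- Lebesgue measure on `[-R, R]`. -/
noncomputable abbrev symVol (R : ℝ) : Measure ℝ := volume.restrict (Icc (-R) R)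

lemma _root_.ContinuousOn.memLp_Icc {E : Type*} [NormedAddCommGroup E] {F : ℝ → E}
    {a b : ℝ} (hF : ContinuousOn F (Icc a b)) : MemLp F 2 (volume.restrict (Icc a b)) := by
  obtain ⟨C, hC⟩ := isCompact_Icc.exists_bound_of_continuousOn hF
  exact MemLp.of_bound (hF.aestronglyMeasurable measurableSet_Icc) C
    ((ae_restrict_mem measurableSet_Icc).mono hC)

lemma memLp_polynomial (R : ℝ) (p : ℝ[X]) : MemLp (fun x => p.eval x) 2 (symVol R) :=
  p.continuous.continuousOn.memLp_Icc

lemma _root_.MeasureTheory.MemLp.sub_polynomial {R : ℝ} {g : ℝ → ℝ} (hg : MemLp g 2 (symVol R))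
    (p : ℝ[X]) : MemLp (fun x => g x - p.eval x) 2 (symVol R) :=
  hg.sub (memLp_polynomial R p)

lemma integral_symVol {R : ℝ} (hR : 0 ≤ R) (g : ℝ → ℝ) :
    ∫ x, g x ∂(symVol R) = ∫ x in (-R)..R, g x := by
  rw [intervalIntegral.integral_of_le (by linarith), integral_Icc_eq_integral_Ioc]

lemma exists_approx_of_polynomial_eLpNorm {R : ℝ} (hR : 0 < R) (N : ℕ) (p : ℝ[X]) :
    ∃ q : ℝ[X], q.natDegree ≤ N ∧ eLpNorm (fun x => p.eval x - q.eval x) 2 (symVol R) ≤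
      ENNReal.ofReal (R / ((N : ℝ) + 1)) *
        eLpNorm (fun x => (derivative p).eval x) 2 (symVol R) := by
  obtain ⟨q, hq, h⟩ := exists_approx_of_polynomial hR N p
  refine ⟨q, hq, ?_⟩
  rw [eLpNorm_two_eq ((memLp_polynomial R p).sub_polynomial q),
    eLpNorm_two_eq (memLp_polynomial R _), ← ENNReal.ofReal_mul (by positivity)]
  refine ENNReal.ofReal_le_ofReal ?_
  simp only [Real.norm_eq_abs, sq_abs]
  rw [integral_symVol hR.le, integral_symVol hR.le]
  refine (Real.sqrt_le_sqrt h).trans_eq ?_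
  rw [Real.sqrt_mul (by positivity), Real.sqrt_sq (by positivity)]

/-- Density of bounded continuous functions in L² combined with Weierstrass approximation; K = √(2R)
converts a uniform error into an L² error. -/
lemma exists_polynomial_eLpNorm_sub_le {R : ℝ} (hR : 0 < R) {g : ℝ → ℝ}
    (hg : MemLp g 2 (symVol R)) {ε : ℝ} (hε : 0 < ε) :
    ∃ p : ℝ[X], eLpNorm (fun x => g x - p.eval x) 2 (symVol R) ≤ ENNReal.ofReal ε := by
  obtain ⟨φ, hφ, hφm⟩ := hg.exists_boundedContinuous_eLpNorm_sub_le (by norm_num)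
    (ε := ENNReal.ofReal (ε / 2)) (by simpa using hε)
  obtain ⟨K, hKd⟩ : ∃ K, K = Real.sqrt (2 * R) := ⟨_, rfl⟩
  have hK : 0 < K := hKd ▸ Real.sqrt_pos.2 (by positivity)
  obtain ⟨p, hp⟩ := exists_polynomial_near_of_continuousOn (-R) R φ φ.continuous.continuousOn
    (ε / (2 * K)) (by positivity)
  refine ⟨p, ?_⟩
  have h2 : eLpNorm (fun x => φ x - p.eval x) 2 (symVol R) ≤ ENNReal.ofReal (ε / 2) := by
    refine (eLpNorm_le_of_ae_bound (C := ε / (2 * K)) ?_).trans ?_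
    · refine (ae_restrict_mem measurableSet_Icc).mono fun x hx => ?_
      rw [Real.norm_eq_abs, abs_sub_comm]
      exact (hp x hx).le
    · rw [Measure.restrict_apply_univ, Real.volume_Icc, ENNReal.ofReal_rpow_of_pos (by linarith),
        ← ENNReal.ofReal_mul (Real.rpow_nonneg (by linarith) _)]
      refine ENNReal.ofReal_le_ofReal (le_of_eq ?_)
      have : (R - -R) ^ (ENNReal.toReal 2)⁻¹ = K := by
        rw [show R - -R = 2 * R by ring, hKd, Real.sqrt_eq_rpow]
        norm_num
      rw [this]
      field_simp
  calc eLpNorm (fun x => g x - p.eval x) 2 (symVol R)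
      = eLpNorm ((g - (φ : ℝ → ℝ)) + fun x => φ x - p.eval x) 2 (symVol R) := by
        congr 1; ext x; simp
    _ ≤ ENNReal.ofReal (ε / 2) + ENNReal.ofReal (ε / 2) :=
        (eLpNorm_add_le (hg.sub hφm).1 (hφm.sub_polynomial p).1 (by norm_num)).trans
          (add_le_add hφ h2)
    _ = ENNReal.ofReal ε := by
        rw [← ENNReal.ofReal_add (by positivity) (by positivity), add_halves]

/-- Each factor (2R)^(1/2) has its own source: Cauchy–Schwarz bounds the primitive pointwise, and
integrating that constant bound over the interval gives the second. -/
lemma eLpNorm_primitive_le {R : ℝ} (hR : 0 < R) {w : ℝ → ℝ} (hw : MemLp w 2 (symVol R)) :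
    eLpNorm (fun x => ∫ t in (-R)..x, w t) 2 (symVol R) ≤
      ENNReal.ofReal (2 * R) * eLpNorm w 2 (symVol R) := by
  have hvol : symVol R univ = ENNReal.ofReal (2 * R) := by
    rw [Measure.restrict_apply_univ, Real.volume_Icc]; congr 1; ring
  have h1 : eLpNorm w 1 (symVol R) ≤
      eLpNorm w 2 (symVol R) * ENNReal.ofReal (2 * R) ^ (1 / 2 : ℝ) := by
    have := eLpNorm_le_eLpNorm_mul_rpow_measure_univ (p := 1) (q := 2) (by norm_num) hw.1
    rw [hvol] at this
    convert this using 3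
    norm_num
  have hfin : eLpNorm w 1 (symVol R) ≠ ⊤ := (hw.mono_exponent (by norm_num)).2.ne
  have h2 : ∀ᵐ x ∂(symVol R), ‖∫ t in (-R)..x, w t‖ ≤ (eLpNorm w 1 (symVol R)).toReal := by
    refine (ae_restrict_mem measurableSet_Icc).mono fun x hx => ?_
    rw [← ENNReal.ofReal_le_iff_le_toReal hfin, ofReal_norm,
      intervalIntegral.integral_of_le hx.1, eLpNorm_one_eq_lintegral_enorm]
    refine (enorm_integral_le_lintegral_enorm _).trans (lintegral_mono_set ?_)
    exact fun t ht => ⟨ht.1.le, ht.2.trans hx.2⟩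
  refine (eLpNorm_le_of_ae_bound h2).trans ?_
  rw [hvol, ENNReal.ofReal_toReal hfin]
  have h3 : ENNReal.ofReal (2 * R) ^ (ENNReal.toReal 2)⁻¹ =
      ENNReal.ofReal (2 * R) ^ (1 / 2 : ℝ) := by norm_num
  rw [h3]
  calc _ ≤ ENNReal.ofReal (2 * R) ^ (1 / 2 : ℝ) *
        (eLpNorm w 2 (symVol R) * ENNReal.ofReal (2 * R) ^ (1 / 2 : ℝ)) := by gcongr
    _ = (ENNReal.ofReal (2 * R) ^ (1 / 2 : ℝ) * ENNReal.ofReal (2 * R) ^ (1 / 2 : ℝ)) *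
        eLpNorm w 2 (symVol R) := by ring
    _ = _ := by
      rw [← ENNReal.rpow_add _ _ (by simpa using hR) ENNReal.ofReal_ne_top, add_halves,
        ENNReal.rpow_one]

lemma exists_derivative_eq (p : ℝ[X]) :
    ∃ P : ℝ[X], derivative P = p ∧ P.natDegree ≤ p.natDegree + 1 := by
  refine ⟨∑ i ∈ Finset.range (p.natDegree + 1), C (p.coeff i / (i + 1)) * X ^ (i + 1), ?_, ?_⟩
  · conv_rhs => rw [p.as_sum_range_C_mul_X_pow]
    rw [derivative_sum]
    refine Finset.sum_congr rfl fun i _ => ?_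
    rw [derivative_C_mul_X_pow]
    have : (i : ℝ) + 1 ≠ 0 := by positivity
    push_cast
    simp [div_mul_cancel₀ _ this]
  · refine natDegree_sum_le_of_forall_le _ _ fun i hi => ?_
    refine (natDegree_C_mul_X_pow_le _ _).trans ?_
    have := Finset.mem_range.1 hi
    omega

lemma intervalIntegrable_of_memLp {R : ℝ} {w : ℝ → ℝ} (hw : MemLp w 2 (symVol R))
    {x y : ℝ} (hx : x ∈ Icc (-R) R) (hy : y ∈ Icc (-R) R) : IntervalIntegrable w volume x y := by
  have h : IntegrableOn w (Icc (-R) R) := hw.integrable (by norm_num)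
  exact intervalIntegrable_iff.2 (h.mono_set (uIoc_subset_uIcc.trans (uIcc_subset_Icc hx hy)))

/-- Approximation of an absolutely continuous function whose derivative is in `L²`. -/
lemma exists_approx_of_primitive {R : ℝ} (hR : 0 < R) {u w : ℝ → ℝ}
    (hw : MemLp w 2 (symVol R)) {c : ℝ}
    (hu : u =ᵐ[symVol R] fun x => c + ∫ t in (-R)..x, w t) (N : ℕ) {δ : ℝ} (hδ : 0 < δ) :
    ∃ q : ℝ[X], q.natDegree ≤ N ∧ eLpNorm (fun x => u x - q.eval x) 2 (symVol R) ≤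
      ENNReal.ofReal (R / ((N : ℝ) + 1)) * eLpNorm w 2 (symVol R) + ENNReal.ofReal δ := by
  set r := R / ((N : ℝ) + 1) with hr
  have hr0 : 0 < r := by positivity
  -- The error η of p is paid twice, with factor 2R through the primitive and with factor r in the
  -- norm of the derivative, for a total of δ.
  set η := δ / (r + 2 * R) with hη
  have hη0 : 0 < η := by positivity
  obtain ⟨p, hp⟩ := exists_polynomial_eLpNorm_sub_le hR hw hη0
  obtain ⟨P, hP, -⟩ := exists_derivative_eq p
  -- Normalised to take the value c at -R, so that u - P' is the primitive of w - p.
  set P' := P + C (c - P.eval (-R)) with hP'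
  obtain ⟨q, hq, hPq⟩ := exists_approx_of_polynomial_eLpNorm hR N P'
  refine ⟨q, hq, ?_⟩
  have hd : derivative P' = p := by simp [hP', hP]
  rw [hd] at hPq
  have hwp := hw.sub_polynomial p
  have hup : (fun x => u x - P'.eval x) =ᵐ[symVol R] fun x => ∫ t in (-R)..x, (w t - p.eval t) := by
    filter_upwards [hu, ae_restrict_mem measurableSet_Icc] with x hx hxI
    have hl : -R ∈ Icc (-R) R := ⟨le_rfl, by linarith⟩
    rw [hx, intervalIntegral.integral_sub (intervalIntegrable_of_memLp hw hl hxI)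
      (p.continuous.intervalIntegrable _ _)]
    have : ∫ t in (-R)..x, p.eval t = P.eval x - P.eval (-R) :=
      intervalIntegral.integral_eq_sub_of_hasDerivAt
        (fun t _ => by simpa [hP] using P.hasDerivAt t) (p.continuous.intervalIntegrable _ _)
    rw [this, hP', eval_add, eval_C]
    ring
  have h1 : eLpNorm (fun x => u x - P'.eval x) 2 (symVol R) ≤
      ENNReal.ofReal (2 * R) * ENNReal.ofReal η := by
    rw [eLpNorm_congr_ae hup]
    exact (eLpNorm_primitive_le hR hwp).trans (by gcongr)
  have h2 : eLpNorm (fun x => p.eval x) 2 (symVol R) ≤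
      eLpNorm w 2 (symVol R) + ENNReal.ofReal η := by
    have : (fun x => p.eval x) = w - (fun x => w x - p.eval x) := by ext x; simp
    rw [this]
    exact (eLpNorm_sub_le hw.1 hwp.1 (by norm_num)).trans (by gcongr)
  have hum : AEStronglyMeasurable (fun x => u x - P'.eval x) (symVol R) := by
    have h3 := ((intervalIntegrable_of_memLp hwp (x := -R) (y := R) ⟨le_rfl, by linarith⟩
      ⟨by linarith, le_rfl⟩).absolutelyContinuousOnInterval_intervalIntegral
        (c := -R) (by simp)).continuousOn
    rw [uIcc_of_le (by linarith)] at h3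
    exact (h3.aestronglyMeasurable measurableSet_Icc).congr hup.symm
  calc eLpNorm (fun x => u x - q.eval x) 2 (symVol R)
      = eLpNorm ((fun x => u x - P'.eval x) + fun x => P'.eval x - q.eval x) 2 (symVol R) := by
        congr 1; ext x; simp
    _ ≤ ENNReal.ofReal (2 * R) * ENNReal.ofReal η +
        ENNReal.ofReal r * (eLpNorm w 2 (symVol R) + ENNReal.ofReal η) :=
        (eLpNorm_add_le hum ((memLp_polynomial R P').sub_polynomial q).1
          (by norm_num)).trans (add_le_add h1 (hPq.trans (by gcongr)))
    _ = ENNReal.ofReal r * eLpNorm w 2 (symVol R) + ENNReal.ofReal δ := by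
        rw [mul_add, ← ENNReal.ofReal_mul (by positivity), ← ENNReal.ofReal_mul hr0.le,
          add_left_comm, ← ENNReal.ofReal_add (by positivity) (by positivity)]
        congr 2
        rw [hη]; field_simp; ring

/-! ### Weak derivatives and primitives. -/

/-- `v` is a weak derivative of the scalar function `u` on `(-R, R)`. -/
def HasScalarWeakDeriv (R : ℝ) (u v : ℝ → ℝ) : Prop :=
  ∀ φ : ℝ → ℝ, ContDiff ℝ ∞ φ → HasCompactSupport φ → tsupport φ ⊆ Ioo (-R) R →
    ∫ z, deriv φ z * u z ∂(symVol R) = -∫ z, φ z * v z ∂(symVol R)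

lemma exists_Icc_of_tsupport_subset {R : ℝ} (hR : 0 < R) {φ : ℝ → ℝ} (hc : HasCompactSupport φ)
    (hs : tsupport φ ⊆ Ioo (-R) R) :
    ∃ r, 0 < r ∧ r < R ∧ tsupport φ ⊆ Icc (-r) r := by
  rcases (tsupport φ).eq_empty_or_nonempty with h | h
  · exact ⟨R / 2, by positivity, by linarith, by simp [h]⟩
  · obtain ⟨x, hx, hmax⟩ := hc.isCompact.exists_isMaxOn h (f := fun x => |x|) (by fun_prop)
    have hxR : |x| < R := abs_lt.2 (hs hx)
    refine ⟨max |x| (R / 2), lt_max_of_lt_right (by positivity), max_lt hxR (by linarith), ?_⟩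
    exact fun y hy => abs_le.1 ((hmax hy).trans (le_max_left _ _))

/-- The lemma of du Bois-Reymond. -/
lemma exists_ae_eq_const {R : ℝ} (hR : 0 < R) {F : ℝ → ℝ} (hF : MemLp F 2 (symVol R))
    (h : ∀ φ : ℝ → ℝ, ContDiff ℝ ∞ φ → HasCompactSupport φ → tsupport φ ⊆ Ioo (-R) R →
      ∫ z, deriv φ z * F z ∂(symVol R) = 0) :
    ∃ c : ℝ, F =ᵐ[symVol R] fun _ => c := by
  have hFi : Integrable F (symVol R) := hF.integrable (by norm_num)
  have hmul : ∀ φ : ℝ → ℝ, Continuous φ → Integrable (fun z => φ z * F z) (symVol R) :=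
    fun φ hφ => (MemLp.integrable_mul (p := 2) (q := 2) hφ.continuousOn.memLp_Icc hF)
  let b : ContDiffBump (0 : ℝ) := ⟨R / 4, R / 2, by positivity, by linarith⟩
  set ψ : ℝ → ℝ := b.normed volume with hψ
  have hψc : ContDiff ℝ ∞ ψ := b.contDiff_normed (n := ⊤)
  have hψ1 : ∫ x, ψ x = 1 := b.integral_normed
  have hψs : tsupport ψ ⊆ Icc (-(R / 2)) (R / 2) := by
    rw [hψ, b.tsupport_normed_eq, Real.closedBall_eq_Icc, zero_sub, zero_add]
  have hψi : Integrable ψ := b.integrable_normed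
  -- The constant is forced: integrating F = c against ψ, which has mass 1, gives this value.
  set c := ∫ z, ψ z * F z ∂(symVol R) with hc
  refine ⟨c, ?_⟩
  have key : ∀ᵐ x, x ∈ Ioo (-R) R → F x - c = 0 := by
    refine isOpen_Ioo.ae_eq_zero_of_integral_contDiff_smul_eq_zero (f := fun x => F x - c) ?_ ?_
    · have : IntegrableOn (fun x => F x - c) (Icc (-R) R) := hFi.sub (integrable_const c)
      exact (this.mono_set Ioo_subset_Icc_self).locallyIntegrableOn
    · intro φ hφ hφc hφs
      have hφi : Integrable φ := hφ.continuous.integrable_of_hasCompactSupport hφc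
      obtain ⟨r₀, hr₀, hr₀R, hφr₀⟩ := exists_Icc_of_tsupport_subset hR hφc hφs
      set r := max r₀ (R / 2)
      have hrR : r < R := max_lt hr₀R (by linarith)
      set κ := ∫ x, φ x with hκ
      -- Removing the mass of φ makes the primitive Φ compactly supported, hence an admissible test
      -- function with derivative G.
      set G : ℝ → ℝ := fun x => φ x - κ * ψ x with hG
      have hGc : ContDiff ℝ ∞ G := hφ.sub (contDiff_const.mul hψc)
      have hG0 : ∀ x, x ∉ Icc (-r) r → G x = 0 := by
        intro x hx
        have h1 : φ x = 0 := image_eq_zero_of_notMem_tsupport fun hx' =>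
          hx (Icc_subset_Icc (neg_le_neg (le_max_left _ _)) (le_max_left _ _) (hφr₀ hx'))
        have h2 : ψ x = 0 := image_eq_zero_of_notMem_tsupport fun hx' =>
          hx (Icc_subset_Icc (neg_le_neg (le_max_right _ _)) (le_max_right _ _) (hψs hx'))
        simp [hG, h1, h2]
      have hGint : ∫ x, G x = 0 := by
        rw [integral_sub hφi (hψi.const_mul κ), integral_const_mul, hψ1, hκ]; ring
      set Φ : ℝ → ℝ := fun x => ∫ t in (-R)..x, G t with hΦ
      have hΦd : ∀ x, HasDerivAt Φ (G x) x := fun x =>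
        intervalIntegral.integral_hasDerivAt_right (hGc.continuous.intervalIntegrable _ _)
          (hGc.continuous.stronglyMeasurableAtFilter _ _) hGc.continuous.continuousAt
      have hΦd' : deriv Φ = G := funext fun x => (hΦd x).deriv
      have hΦc : ContDiff ℝ ∞ Φ := by
        rw [contDiff_infty_iff_deriv, hΦd']
        exact ⟨fun x => (hΦd x).differentiableAt, hGc⟩
      have hΦs : tsupport Φ ⊆ Icc (-r) r := by
        refine closure_minimal (fun x hx => ?_) isClosed_Icc
        by_contra hxr
        refine hx ?_
        rcases lt_or_ge x (-r) with hlt | hge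
        · refine intervalIntegral.integral_zero_ae (ae_of_all _ fun t ht => hG0 t fun htr => ?_)
          have := (uIoc_subset_uIcc ht)
          have : t ≤ max (-R) x := this.2
          rcases le_max_iff.1 this with h | h <;> linarith [htr.1]
        · have hxr' : r < x := by
            by_contra hle
            exact hxr ⟨hge, not_lt.1 hle⟩
          have : Φ x = ∫ t, G t := by
            rw [hΦ]
            refine intervalIntegral.integral_eq_integral_of_support_subset fun t ht => ?_
            have := not_imp_comm.1 (hG0 t) ht
            exact ⟨by linarith [this.1], by linarith [this.2]⟩
          rw [this, hGint]
      have hΦ0 := h Φ hΦc (isCompact_Icc.of_isClosed_subset (isClosed_tsupport _) hΦs)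
        (hΦs.trans fun x hx => ⟨by linarith [hx.1], by linarith [hx.2]⟩)
      rw [hΦd'] at hΦ0
      have hφF : ∫ z, φ z * F z ∂(symVol R) = κ * c := by
        have : ∀ z, G z * F z = φ z * F z - κ * (ψ z * F z) := fun z => by rw [hG]; ring
        simp_rw [this] at hΦ0
        rw [integral_sub (hmul φ hφ.continuous) ((hmul ψ hψc.continuous).const_mul κ),
          integral_const_mul] at hΦ0
        linarith
      have hκI : ∫ z, φ z ∂(symVol R) = κ := setIntegral_eq_integral_of_forall_compl_eq_zero
        fun x hx => image_eq_zero_of_notMem_tsupport fun hx' => hx (Ioo_subset_Icc_self (hφs hx'))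
      calc ∫ x, φ x • (F x - c) = ∫ x, φ x * (F x - c) ∂(symVol R) := by
            refine (setIntegral_eq_integral_of_forall_compl_eq_zero fun x hx => ?_).symm
            rw [image_eq_zero_of_notMem_tsupport fun hx' => hx (Ioo_subset_Icc_self (hφs hx'))]
            exact zero_mul _
        _ = 0 := by
            simp_rw [mul_sub]
            rw [integral_sub (hmul φ hφ.continuous) (hφi.restrict.mul_const c),
              integral_mul_const, hφF, hκI, sub_self]
  have : ∀ᵐ x ∂(volume.restrict (Ioo (-R) R)), F x = c := by
    rw [ae_restrict_iff' measurableSet_Ioo]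
    filter_upwards [key] with x hx hxI
    linarith [hx hxI]
  rwa [restrict_Ioo_eq_restrict_Icc] at this

/-- Integration by parts for absolutely continuous functions shows that the primitive of w also has
weak derivative w. Its difference from u has weak derivative zero, so `exists_ae_eq_const` applies.
-/
lemma exists_ae_eq_primitive {R : ℝ} (hR : 0 < R) {u w : ℝ → ℝ} (hu : MemLp u 2 (symVol R))
    (hw : MemLp w 2 (symVol R)) (huw : HasScalarWeakDeriv R u w) :
    ∃ c : ℝ, u =ᵐ[symVol R] fun x => c + ∫ t in (-R)..x, w t := by
  have hRl : -R ≤ R := by linarith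
  have hwi : IntervalIntegrable w volume (-R) R :=
    intervalIntegrable_of_memLp hw ⟨le_rfl, hRl⟩ ⟨hRl, le_rfl⟩
  set W : ℝ → ℝ := fun x => ∫ t in (-R)..x, w t with hW
  have hWac : AbsolutelyContinuousOnInterval W (-R) R :=
    hwi.absolutelyContinuousOnInterval_intervalIntegral (by simp)
  have hWm : MemLp W 2 (symVol R) := by
    have := hWac.continuousOn
    rw [uIcc_of_le hRl] at this
    exact this.memLp_Icc
  have hWd : ∀ᵐ x, x ∈ Icc (-R) R → deriv W x = w x := by
    filter_upwards [hwi.ae_hasDerivAt_integral] with x hx hxI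
    rw [uIcc_of_le hRl] at hx
    exact (hx hxI (-R) ⟨le_rfl, hRl⟩).deriv
  obtain ⟨c, hc⟩ := exists_ae_eq_const hR (hu.sub hWm) (by
    intro φ hφ hφc hφs
    have hφm : MemLp (deriv φ) 2 (symVol R) :=
      (hφ.continuous_deriv (by simp)).continuousOn.memLp_Icc
    have h0 : ∀ x, x ∉ Ioo (-R) R → φ x = 0 := fun x hx =>
      image_eq_zero_of_notMem_tsupport fun hx' => hx (hφs hx')
    have hparts := AbsolutelyContinuousOnInterval.integral_mul_deriv_eq_deriv_mul
      ((hφ.of_le (by simp) : ContDiff ℝ 1 φ).contDiffOn.absolutelyContinuousOnInterval) hWac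
    rw [h0 R (by simp), h0 (-R) (by simp), ← integral_symVol hR.le, ← integral_symVol hR.le]
      at hparts
    have hcongr : ∫ x, φ x * deriv W x ∂(symVol R) = ∫ x, φ x * w x ∂(symVol R) := by
      refine integral_congr_ae ?_
      filter_upwards [ae_restrict_of_ae hWd, ae_restrict_mem measurableSet_Icc] with x hx hxI
      rw [hx hxI]
    simp_rw [Pi.sub_apply, mul_sub]
    refine (integral_sub (MemLp.integrable_mul (p := 2) (q := 2) hφm hu)
      (MemLp.integrable_mul (p := 2) (q := 2) hφm hWm)).trans ?_
    simp only [Pi.mul_apply]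
    rw [huw φ hφ hφc hφs, ← hcongr, hparts]
    ring)
  refine ⟨c, hc.mono fun x hx => ?_⟩
  simp only [Pi.sub_apply] at hx
  linarith

/-! ### Polynomial approximation rates: gaining one derivative. -/

/-- `g` is approximated in `L²(-R, R)` by polynomials of degree at most `N` up to
`O((N + 1) ^ (-r))`. -/
def HasPolynomialRate (R r : ℝ) (g : ℝ → ℝ) : Prop :=
  ∃ K, 0 ≤ K ∧ ∀ N : ℕ, ∃ p : ℝ[X], p.natDegree ≤ N ∧
    eLpNorm (fun x => g x - p.eval x) 2 (symVol R) ≤ ENNReal.ofReal (K * ((N : ℝ) + 1) ^ (-r))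

lemma HasPolynomialRate.zero {R : ℝ} {g : ℝ → ℝ} (hg : MemLp g 2 (symVol R)) :
    HasPolynomialRate R 0 g := by
  refine ⟨(eLpNorm g 2 (symVol R)).toReal, ENNReal.toReal_nonneg, fun N => ⟨0, by simp, ?_⟩⟩
  simp [ENNReal.ofReal_toReal hg.2.ne]

/-- If q approximates w and Q' = q, then u - Q has the small derivative w - q, and the first-order
estimate applied to u - Q gains one more power of N. -/
theorem HasPolynomialRate.of_weakDeriv {R r : ℝ} (hR : 0 < R) (hr : 0 ≤ r) {u w : ℝ → ℝ}
    (hu : MemLp u 2 (symVol R)) (hw : MemLp w 2 (symVol R)) (huw : HasScalarWeakDeriv R u w)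
    (h : HasPolynomialRate R r w) : HasPolynomialRate R (r + 1) u := by
  obtain ⟨K, hK, h⟩ := h
  obtain ⟨c, hc⟩ := exists_ae_eq_primitive hR hu hw huw
  set U := (eLpNorm u 2 (symVol R)).toReal
  set K' := max U (2 ^ (r + 1) * (R * K + 1)) with hK'
  have hK'0 : 0 ≤ K' := le_max_of_le_left ENNReal.toReal_nonneg
  refine ⟨K', hK'0, fun N => ?_⟩
  -- Taking a primitive raises the degree by one, so degree N + 1 uses an approximant of w of degree
  -- N, and degree 0 uses the zero polynomial.
  rcases N with _ | N
  · refine ⟨0, by simp, ?_⟩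
    simp only [eval_zero, sub_zero, Nat.cast_zero, zero_add, Real.one_rpow, mul_one]
    rw [← ENNReal.ofReal_toReal hu.2.ne]
    exact ENNReal.ofReal_le_ofReal (le_max_left _ _)
  · obtain ⟨q, hq, hqw⟩ := h N
    obtain ⟨Q, hQ, hQd⟩ := exists_derivative_eq q
    have hwq := hw.sub_polynomial q
    have hN : (0 : ℝ) < N + 1 := by positivity
    -- The slack δ of `exists_approx_of_primitive` is taken of the target order.
    have hδ : 0 < ((N : ℝ) + 1) ^ (-(r + 1)) := by positivity
    obtain ⟨p, hp, hpu⟩ := exists_approx_of_primitive hR (u := fun x => u x - Q.eval x) hwq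
      (c := c - Q.eval (-R)) (by
        filter_upwards [hc, ae_restrict_mem measurableSet_Icc] with x hx hxI
        rw [hx]
        rw [intervalIntegral.integral_sub
          (intervalIntegrable_of_memLp hw ⟨le_rfl, by linarith⟩ hxI)
          (q.continuous.intervalIntegrable _ _)]
        have : ∫ t in (-R)..x, q.eval t = Q.eval x - Q.eval (-R) :=
          intervalIntegral.integral_eq_sub_of_hasDerivAt
            (fun t _ => by simpa [hQ] using Q.hasDerivAt t) (q.continuous.intervalIntegrable _ _)
        rw [this]
        ring) N hδ
    refine ⟨Q + p, ?_, ?_⟩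
    · refine (natDegree_add_le _ _).trans (max_le ?_ ?_) <;> omega
    · have he : (fun x => u x - (Q + p).eval x) = fun x => u x - Q.eval x - p.eval x := by
        ext x; simp; ring
      rw [he]
      refine hpu.trans ((add_le_add_left (mul_le_mul_right hqw _) _).trans ?_)
      rw [← ENNReal.ofReal_mul (by positivity), ← ENNReal.ofReal_add (by positivity) hδ.le]
      refine ENNReal.ofReal_le_ofReal ?_
      have h1 : R / ((N : ℝ) + 1) * (K * ((N : ℝ) + 1) ^ (-r)) =
          R * K * ((N : ℝ) + 1) ^ (-(r + 1)) := by
        rw [neg_add, Real.rpow_add hN, Real.rpow_neg_one]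
        field_simp
      -- The degree shift costs 2^(r+1), since N + 2 ≤ 2(N + 1).
      have h2 : ((N : ℝ) + 1) ^ (-(r + 1)) ≤ 2 ^ (r + 1) * (((N + 1 : ℕ) : ℝ) + 1) ^ (-(r + 1)) := by
        rw [Real.rpow_neg hN.le, Real.rpow_neg (by positivity), ← div_eq_mul_inv,
          le_div_iff₀ (by positivity), inv_mul_le_iff₀ (by positivity),
          ← Real.mul_rpow hN.le (by norm_num)]
        refine Real.rpow_le_rpow (by positivity) ?_ (by linarith)
        push_cast
        have : (0 : ℝ) ≤ N := by positivity
        linarith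
      rw [h1]
      calc R * K * ((N : ℝ) + 1) ^ (-(r + 1)) + ((N : ℝ) + 1) ^ (-(r + 1))
          = (R * K + 1) * ((N : ℝ) + 1) ^ (-(r + 1)) := by ring
        _ ≤ (R * K + 1) * (2 ^ (r + 1) * (((N + 1 : ℕ) : ℝ) + 1) ^ (-(r + 1))) := by gcongr
        _ = 2 ^ (r + 1) * (R * K + 1) * (((N + 1 : ℕ) : ℝ) + 1) ^ (-(r + 1)) := by ring
        _ ≤ _ := by gcongr; exact le_max_right _ _

/-! ### Mollification and the fractional rate. -/

lemma exists_mollifier : ∃ (η : ℝ → ℝ) (M : ℝ), ContDiff ℝ ∞ η ∧ ∫ x, η x = 1 ∧ 0 < M ∧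
    (∀ t, η t ≠ 0 → |t| ≤ 1) ∧ (∀ t, |η t| ≤ M) ∧ (∀ t, |deriv η t| ≤ M) := by
  let b : ContDiffBump (0 : ℝ) := ⟨1 / 2, 1, by norm_num, by norm_num⟩
  have hc : ContDiff ℝ ∞ (b.normed volume) := b.contDiff_normed (n := ⊤)
  have hs : HasCompactSupport (b.normed volume) := b.hasCompactSupport_normed
  obtain ⟨M₁, hM₁⟩ := hs.exists_bound_of_continuous hc.continuous
  obtain ⟨M₂, hM₂⟩ := hs.deriv.exists_bound_of_continuous (hc.continuous_deriv (by simp))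
  refine ⟨b.normed volume, max 1 (max M₁ M₂), hc, b.integral_normed, by positivity, ?_, ?_, ?_⟩
  · intro t ht
    have : t ∈ Function.support (b.normed volume) := ht
    rw [b.support_normed_eq, Metric.mem_ball, dist_zero_right] at this
    exact le_of_lt this
  · exact fun t => (hM₁ t).trans (le_max_of_le_right (le_max_left _ _))
  · exact fun t => (hM₂ t).trans (le_max_of_le_right (le_max_right _ _))

lemma exists_mollifier_of_pos : ∃ M : ℝ, 0 < M ∧ ∀ h : ℝ, 0 < h → ∃ ζ : ℝ → ℝ,
    ContDiff ℝ ∞ ζ ∧ HasCompactSupport ζ ∧ ∫ x, ζ x = 1 ∧ ∫ x, deriv ζ x = 0 ∧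
    (∀ t, ζ t ≠ 0 → |t| ≤ h) ∧ (∀ t, deriv ζ t ≠ 0 → |t| ≤ h) ∧
    (∀ t, |ζ t| ≤ M / h) ∧ (∀ t, |deriv ζ t| ≤ M / h ^ 2) := by
  obtain ⟨η, M, hη, hη1, hM, hs, hb, hb'⟩ := exists_mollifier
  refine ⟨M, hM, fun h hh => ?_⟩
  set ζ : ℝ → ℝ := fun t => h⁻¹ * η (h⁻¹ * t) with hζ
  have hζc : ContDiff ℝ ∞ ζ := contDiff_const.mul (hη.comp (contDiff_const.mul contDiff_id))
  have hζs : ∀ t, ζ t ≠ 0 → |t| ≤ h := by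
    intro t ht
    have h1 := hs (h⁻¹ * t) (right_ne_zero_of_mul ht)
    rw [abs_mul, abs_of_pos (inv_pos.2 hh), inv_mul_le_iff₀ hh] at h1
    simpa using h1
  have hts : tsupport ζ ⊆ Icc (-h) h :=
    closure_minimal (fun t ht => abs_le.1 (hζs t ht)) isClosed_Icc
  have hζcs : HasCompactSupport ζ := isCompact_Icc.of_isClosed_subset (isClosed_tsupport _) hts
  have hζd : ∀ t, deriv ζ t = h⁻¹ * (deriv η (h⁻¹ * t) * h⁻¹) := by
    intro t
    have h1 : HasDerivAt (fun t => h⁻¹ * t) h⁻¹ t := by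
      simpa using (hasDerivAt_id t).const_mul h⁻¹
    have h2 : HasDerivAt η (deriv η (h⁻¹ * t)) (h⁻¹ * t) :=
      ((hη.differentiable (by simp)).differentiableAt).hasDerivAt
    exact ((h2.comp t h1).const_mul h⁻¹).deriv
  refine ⟨ζ, hζc, hζcs, ?_, ?_, hζs, ?_, ?_, ?_⟩
  · rw [hζ, integral_const_mul, Measure.integral_comp_mul_left, hη1, inv_inv, abs_of_pos hh,
      smul_eq_mul, mul_one, inv_mul_cancel₀ hh.ne']
  · exact integral_eq_zero_of_hasDerivAt_of_integrable
      (fun t => ((hζc.differentiable (by simp)).differentiableAt).hasDerivAt)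
      ((hζc.continuous_deriv (by simp)).integrable_of_hasCompactSupport hζcs.deriv)
      (hζc.continuous.integrable_of_hasCompactSupport hζcs)
  · intro t ht
    exact abs_le.2 (hts (support_deriv_subset ht))
  · intro t
    rw [hζ]
    simp only
    rw [abs_mul, abs_of_pos (inv_pos.2 hh), div_eq_inv_mul]
    exact mul_le_mul_of_nonneg_left (hb _) (inv_pos.2 hh).le
  · intro t
    rw [hζd, abs_mul, abs_mul, abs_of_pos (inv_pos.2 hh)]
    calc h⁻¹ * (|deriv η (h⁻¹ * t)| * h⁻¹) ≤ h⁻¹ * (M * h⁻¹) := by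
          gcongr
          exact hb' _
      _ = M / h ^ 2 := by field_simp

/-- The square of the Gagliardo seminorm of order `θ` of a scalar function on `(-R, R)`. -/
noncomputable def scalarGagliardoSq (R θ : ℝ) (g : ℝ → ℝ) : ENNReal :=
  ∫⁻ x in Icc (-R) R, ∫⁻ y in Icc (-R) R,
    ‖g x - g y‖ₑ ^ 2 / ENNReal.ofReal (|x - y| ^ (1 + 2 * θ))

lemma sq_lintegral_enorm_le {α : Type*} [MeasurableSpace α] {ν : Measure α} {f : α → ℝ}
    (hf : AEStronglyMeasurable f ν) :
    (∫⁻ y, ‖f y‖ₑ ∂ν) ^ 2 ≤ ν univ * ∫⁻ y, ‖f y‖ₑ ^ 2 ∂ν := by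
  rw [← eLpNorm_one_eq_lintegral_enorm, ← eLpNorm_two_sq]
  have := eLpNorm_le_eLpNorm_mul_rpow_measure_univ (p := 1) (q := 2) (by norm_num) hf
  calc _ ≤ (eLpNorm f 2 ν * ν univ ^ (1 / (1 : ENNReal).toReal - 1 / (2 : ENNReal).toReal)) ^ 2 := by
        gcongr
    _ = (ν univ ^ (1 / 2 : ℝ)) ^ 2 * eLpNorm f 2 ν ^ 2 := by
        rw [mul_pow, mul_comm]; norm_num
    _ = _ := by
        rw [← ENNReal.rpow_natCast, ← ENNReal.rpow_mul]; norm_num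

/-- Functions dominated by local averages of differences are controlled by the Gagliardo
seminorm. -/
lemma lintegral_sq_le_of_local_average {R h A θ : ℝ} (hh : 0 < h) (hA : 0 ≤ A) (hθ : 0 < θ)
    {g F : ℝ → ℝ} (hg : AEStronglyMeasurable g (symVol R))
    (hF : ∀ x ∈ Icc (-R) R, ‖F x‖ₑ ≤ ENNReal.ofReal A *
      ∫⁻ y in Icc (-R) R ∩ Metric.closedBall x (2 * h), ‖g x - g y‖ₑ) :
    ∫⁻ x in Icc (-R) R, ‖F x‖ₑ ^ 2 ≤
      ENNReal.ofReal (A ^ 2 * (4 * h) * (2 * h) ^ (1 + 2 * θ)) * scalarGagliardoSq R θ g := by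
  rw [scalarGagliardoSq, ← lintegral_const_mul' _ _ ENNReal.ofReal_ne_top]
  refine setLIntegral_mono' measurableSet_Icc fun x hx => ?_
  set S := Icc (-R) R ∩ Metric.closedBall x (2 * h) with hS
  have hSm : MeasurableSet S := measurableSet_Icc.inter Metric.isClosed_closedBall.measurableSet
  have hvol : volume.restrict S univ ≤ ENNReal.ofReal (4 * h) := by
    rw [Measure.restrict_apply_univ]
    refine (measure_mono inter_subset_right).trans ?_
    rw [Real.volume_closedBall]
    exact ENNReal.ofReal_le_ofReal (by linarith)
  have hmeas : AEStronglyMeasurable (fun y => g x - g y) (volume.restrict S) :=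
    aestronglyMeasurable_const.sub (hg.mono_measure (Measure.restrict_mono inter_subset_left le_rfl))
  -- On S one has |x - y| ≤ 2h, so inserting the Gagliardo kernel costs at most (2h)^(1+2θ). The
  -- diagonal is harmless because the difference vanishes there.
  have hpt : ∀ y ∈ S, ‖g x - g y‖ₑ ^ 2 ≤ ENNReal.ofReal ((2 * h) ^ (1 + 2 * θ)) *
      (‖g x - g y‖ₑ ^ 2 / ENNReal.ofReal (|x - y| ^ (1 + 2 * θ))) := by
    intro y hy
    rcases eq_or_ne x y with rfl | hxy
    · simp
    · have hpos : 0 < |x - y| := abs_pos.2 (sub_ne_zero.2 hxy)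
      have hle : |x - y| ≤ 2 * h := by
        have := hy.2
        rwa [Metric.mem_closedBall, dist_comm, Real.dist_eq] at this
      have hp : 0 < |x - y| ^ (1 + 2 * θ) := Real.rpow_pos_of_pos hpos _
      rw [← mul_div_assoc, ENNReal.le_div_iff_mul_le (Or.inl (by simpa using hp))
        (Or.inl ENNReal.ofReal_ne_top), mul_comm]
      gcongr
  calc ‖F x‖ₑ ^ 2 ≤ (ENNReal.ofReal A * ∫⁻ y in S, ‖g x - g y‖ₑ) ^ 2 := by
        gcongr
        exact hF x hx
    _ ≤ ENNReal.ofReal A ^ 2 * (ENNReal.ofReal (4 * h) * ∫⁻ y in S, ‖g x - g y‖ₑ ^ 2) := by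
        rw [mul_pow]
        gcongr
        exact (sq_lintegral_enorm_le hmeas).trans (by gcongr)
    _ ≤ ENNReal.ofReal A ^ 2 * (ENNReal.ofReal (4 * h) *
        (ENNReal.ofReal ((2 * h) ^ (1 + 2 * θ)) * ∫⁻ y in Icc (-R) R,
          (‖g x - g y‖ₑ ^ 2 / ENNReal.ofReal (|x - y| ^ (1 + 2 * θ))))) := by
        gcongr
        rw [← lintegral_const_mul' _ _ ENNReal.ofReal_ne_top]
        exact (setLIntegral_mono' hSm hpt).trans (lintegral_mono_set inter_subset_left)
    _ = _ := by
        rw [← mul_assoc, ← mul_assoc, ← ENNReal.ofReal_pow hA, ← ENNReal.ofReal_mul (by positivity),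
          ← ENNReal.ofReal_mul (by positivity)]

/-- The square root of the previous bound, using 4h (2h)^(1+2θ) = 8h² (2h)^(2θ). With A of order 1/h
it gives h^θ, and with A of order 1/h² it gives h^(θ-1). -/
lemma eLpNorm_le_of_local_average {R h A θ : ℝ} (hh : 0 < h) (hA : 0 ≤ A) (hθ : 0 < θ)
    {g F : ℝ → ℝ} (hg : AEStronglyMeasurable g (symVol R)) (hG : scalarGagliardoSq R θ g < ⊤)
    (hF : ∀ x ∈ Icc (-R) R, ‖F x‖ₑ ≤ ENNReal.ofReal A *
      ∫⁻ y in Icc (-R) R ∩ Metric.closedBall x (2 * h), ‖g x - g y‖ₑ) :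
    eLpNorm F 2 (symVol R) ≤ ENNReal.ofReal
      (A * h * (Real.sqrt (8 * (scalarGagliardoSq R θ g).toReal) * (2 * h) ^ θ)) := by
  rw [← ENNReal.pow_le_pow_left_iff two_ne_zero, eLpNorm_two_sq]
  refine (lintegral_sq_le_of_local_average hh hA hθ hg hF).trans_eq ?_
  set G := scalarGagliardoSq R θ g
  have h2 : (0 : ℝ) < 2 * h := by positivity
  rw [← ENNReal.ofReal_toReal hG.ne, ← ENNReal.ofReal_mul (by positivity),
    ← ENNReal.ofReal_pow (by positivity), ENNReal.toReal_ofReal ENNReal.toReal_nonneg, mul_pow,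
    mul_pow _ ((2 * h) ^ θ), Real.sq_sqrt (by positivity), Real.rpow_add h2, Real.rpow_one,
    two_mul θ, Real.rpow_add h2]
  congr 1
  ring

/-- The contraction x ↦ (1 - h/R)x moves points by at most h and into [-R + h, R - h]. The kernel
therefore sees only values of g inside the interval and within 2h of x, and no extension operator is
needed. The mass of ζ is left general to cover both a mollifier (mass 1) and its derivative (mass
0). -/
lemma enorm_convolution_sub_le {R h A : ℝ} (hR : 0 < R) (hh : 0 < h) (hhR : h ≤ R)
    {g ζ : ℝ → ℝ} (hg : Integrable g (symVol R)) (hζ : Continuous ζ) (hζc : HasCompactSupport ζ)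
    (hζs : ∀ t, ζ t ≠ 0 → |t| ≤ h) (hζA : ∀ t, |ζ t| ≤ A) {x : ℝ} (hx : x ∈ Icc (-R) R) :
    ‖(∫ t, ζ ((1 - h / R) * x - t) * (Icc (-R) R).indicator g t) - (∫ t, ζ t) * g x‖ₑ ≤
      ENNReal.ofReal A *
        ∫⁻ y in Icc (-R) R ∩ Metric.closedBall x (2 * h), ‖g x - g y‖ₑ := by
  set S := Icc (-R) R ∩ Metric.closedBall x (2 * h) with hS
  have hSm : MeasurableSet S := measurableSet_Icc.inter Metric.isClosed_closedBall.measurableSet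
  set z := (1 - h / R) * x with hz
  set G := (Icc (-R) R).indicator g with hG
  have hxa : |x| ≤ R := abs_le.2 hx
  have hq1 : h / R ≤ 1 := (div_le_one hR).2 hhR
  have hq0 : 0 < h / R := by positivity
  have hqR : h / R * R = h := by field_simp
  have hza : |z| ≤ R - h := by
    rw [hz, abs_mul, abs_of_nonneg (by linarith)]
    calc (1 - h / R) * |x| ≤ (1 - h / R) * R := by gcongr
      _ = R - h := by rw [sub_mul, hqR, one_mul]
  have hzx : |z - x| ≤ h := by
    have : z - x = -(h / R * x) := by rw [hz]; ring
    rw [this, abs_neg, abs_mul, abs_of_pos hq0]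
    calc h / R * |x| ≤ h / R * R := by gcongr
      _ = h := hqR
  have hsupp : ∀ t, ζ (z - t) ≠ 0 → t ∈ S := by
    intro t ht
    have h1 := abs_le.1 (hζs _ ht)
    have h2 := abs_le.1 hza
    have h3 := abs_le.1 hzx
    refine ⟨⟨by linarith, by linarith⟩, ?_⟩
    rw [Metric.mem_closedBall, Real.dist_eq, abs_le]
    constructor <;> linarith
  have hζz : Continuous fun t => ζ (z - t) := by fun_prop
  have hζi : Integrable fun t => ζ (z - t) :=
    (hζ.integrable_of_hasCompactSupport hζc).comp_sub_left z
  have hGi : Integrable G := (integrable_indicator_iff measurableSet_Icc).2 hg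
  have hmul : Integrable fun t => ζ (z - t) * G t :=
    hGi.bdd_mul hζz.aestronglyMeasurable (c := A) (ae_of_all _ fun t => hζA _)
  have heq : (∫ t, ζ (z - t) * G t) - (∫ t, ζ t) * g x = ∫ t, ζ (z - t) * (G t - g x) := by
    simp_rw [mul_sub]
    rw [integral_sub hmul (hζi.mul_const _), integral_mul_const, integral_sub_left_eq_self ζ]
  rw [heq]
  calc _ ≤ ∫⁻ t, ‖ζ (z - t) * (G t - g x)‖ₑ := enorm_integral_le_lintegral_enorm _
    _ = ∫⁻ t in S, ‖ζ (z - t) * (G t - g x)‖ₑ := by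
        refine (setLIntegral_eq_of_support_subset fun t ht => hsupp t ?_).symm
        intro h0
        simp [h0] at ht
    _ ≤ ∫⁻ t in S, ENNReal.ofReal A * ‖g x - g t‖ₑ := by
        refine setLIntegral_mono' hSm fun t ht => ?_
        rw [enorm_mul, hG, indicator_of_mem ht.1, enorm_sub_rev]
        gcongr
        rw [← ofReal_norm]
        exact ENNReal.ofReal_le_ofReal (hζA _)
    _ = _ := lintegral_const_mul' _ _ ENNReal.ofReal_ne_top

/-- With v the contracted mollification of g at scale h = R/(N+1), ‖g - v‖ is of order h^θ and ‖v'‖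
of order h^(θ-1). The first-order estimate multiplies the latter by h, so both errors have the same
order. -/
theorem HasPolynomialRate.of_gagliardo {R θ : ℝ} (hR : 0 < R) (hθ : 0 < θ) {g : ℝ → ℝ}
    (hg : MemLp g 2 (symVol R)) (hG : scalarGagliardoSq R θ g < ⊤) :
    HasPolynomialRate R θ g := by
  obtain ⟨M, hM, hmoll⟩ := exists_mollifier_of_pos
  have hgi : Integrable g (symVol R) := hg.integrable (by norm_num)
  set B := Real.sqrt (8 * (scalarGagliardoSq R θ g).toReal) with hB
  have hB0 : 0 ≤ B := Real.sqrt_nonneg _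
  refine ⟨2 * (M * B * (2 * R) ^ θ) + 1, by positivity, fun N => ?_⟩
  have hN : (0 : ℝ) < N + 1 := by positivity
  set h := R / ((N : ℝ) + 1) with hh
  have hh0 : 0 < h := by positivity
  have hhR : h ≤ R := div_le_self hR.le (by linarith [(Nat.cast_nonneg N : (0 : ℝ) ≤ N)])
  obtain ⟨ζ, hζ, hζc, hζ1, hζ0, hζs, hζs', hζM, hζM'⟩ := hmoll h hh0
  have hζd : Continuous (deriv ζ) := hζ.continuous_deriv (by simp)
  set G := (Icc (-R) R).indicator g with hGdef
  have hGi : Integrable G := (integrable_indicator_iff measurableSet_Icc).2 hgi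
  set c := 1 - h / R with hc
  have hc0 : 0 ≤ c := by rw [hc, sub_nonneg]; exact (div_le_one hR).2 hhR
  have hc1 : c ≤ 1 := by rw [hc]; linarith [div_pos hh0 hR]
  set V : ℝ → ℝ := convolution ζ G (ContinuousLinearMap.mul ℝ ℝ) volume with hV
  set V' : ℝ → ℝ := convolution (deriv ζ) G (ContinuousLinearMap.mul ℝ ℝ) volume with hV'
  have hVe : ∀ x, V x = ∫ t, ζ (x - t) * G t := fun x => convolution_mul_swap
  have hVe' : ∀ x, V' x = ∫ t, deriv ζ (x - t) * G t := fun x => convolution_mul_swap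
  have hVd : ∀ x, HasDerivAt V (V' x) x := fun x =>
    hζc.hasDerivAt_convolution_left _ (hζ.of_le (by simp)) hGi.locallyIntegrable x
  have hVc' : Continuous V' := hζc.deriv.continuous_convolution_left _ hζd hGi.locallyIntegrable
  set v : ℝ → ℝ := fun x => V (c * x) with hv
  set v' : ℝ → ℝ := fun x => c * V' (c * x) with hv'
  have hvd : ∀ x, HasDerivAt v (v' x) x := by
    intro x
    have h1 : HasDerivAt (fun x => c * x) c x := by simpa using (hasDerivAt_id x).const_mul c
    have := (hVd (c * x)).comp x h1
    rwa [mul_comm] at this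
  have hvc : Continuous v := continuous_iff_continuousAt.2 fun x => (hvd x).continuousAt
  have hvc' : Continuous v' := by fun_prop
  have hvm : MemLp v 2 (symVol R) := hvc.continuousOn.memLp_Icc
  have hvm' : MemLp v' 2 (symVol R) := hvc'.continuousOn.memLp_Icc
  set T := M * (B * (2 * h) ^ θ) with hT
  have hT0 : 0 ≤ T := by positivity
  have h1 : eLpNorm (fun x => g x - v x) 2 (symVol R) ≤ ENNReal.ofReal T := by
    refine (eLpNorm_le_of_local_average hh0 (A := M / h) (by positivity) hθ hg.1 hG
      fun x hx => ?_).trans_eq ?_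
    · rw [enorm_sub_rev]
      have := enorm_convolution_sub_le hR hh0 hhR hgi hζ.continuous hζc hζs hζM hx
      rwa [hζ1, one_mul, ← hVe] at this
    · rw [div_mul_cancel₀ _ hh0.ne']
  -- The derivative of the kernel has integral zero, so V' too is bounded by local averages of
  -- differences of g.
  have h2 : eLpNorm v' 2 (symVol R) ≤ ENNReal.ofReal (T / h) := by
    refine (eLpNorm_le_of_local_average hh0 (A := M / h ^ 2) (by positivity) hθ hg.1 hG
      fun x hx => ?_).trans_eq ?_
    · have := enorm_convolution_sub_le hR hh0 hhR hgi hζd hζc.deriv hζs' hζM' hx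
      rw [hζ0, zero_mul, sub_zero, ← hVe'] at this
      rw [hv', enorm_mul]
      refine le_trans (mul_le_of_le_one_left' ?_) this
      rw [← ofReal_norm, Real.norm_of_nonneg hc0]
      exact ENNReal.ofReal_le_one.2 hc1
    · congr 1
      rw [hT, ← hB]
      field_simp
  have hδ : 0 < ((N : ℝ) + 1) ^ (-θ) := by positivity
  obtain ⟨p, hp, hpv⟩ := exists_approx_of_primitive hR hvm' (u := v) (c := v (-R))
    (ae_of_all _ fun x => by
      change v x = v (-R) + ∫ t in (-R)..x, v' t
      rw [intervalIntegral.integral_eq_sub_of_hasDerivAt (fun t _ => hvd t)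
        (hvc'.intervalIntegrable _ _)]
      ring) N hδ
  refine ⟨p, hp, ?_⟩
  calc eLpNorm (fun x => g x - p.eval x) 2 (symVol R)
      = eLpNorm ((fun x => g x - v x) + fun x => v x - p.eval x) 2 (symVol R) := by
        congr 1; ext x; simp
    _ ≤ ENNReal.ofReal T + (ENNReal.ofReal h * ENNReal.ofReal (T / h) +
        ENNReal.ofReal (((N : ℝ) + 1) ^ (-θ))) :=
        (eLpNorm_add_le (hg.sub hvm).1 (hvm.sub_polynomial p).1 (by norm_num)).trans
          (add_le_add h1 (hpv.trans (by gcongr)))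
    _ = ENNReal.ofReal (T + (T + ((N : ℝ) + 1) ^ (-θ))) := by
        rw [← ENNReal.ofReal_mul hh0.le, mul_div_cancel₀ _ hh0.ne',
          ← ENNReal.ofReal_add hT0 hδ.le, ← ENNReal.ofReal_add hT0 (by positivity)]
    _ = _ := by
        congr 1
        have : (2 * h) ^ θ = (2 * R) ^ θ * ((N : ℝ) + 1) ^ (-θ) := by
          rw [hh, ← mul_div_assoc, Real.div_rpow (by positivity) hN.le, Real.rpow_neg hN.le,
            div_eq_mul_inv]
        rw [hT, this]
        ring

end PCEGalerkin

namespace PCEGalerkin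

/-! ### Vector-valued curves: Sobolev rates and the inverse inequality. -/

lemma sqrt_three_pos : 0 < Real.sqrt 3 := Real.sqrt_pos.2 (by norm_num)

lemma MemLp.component {n : ℕ} {μ : Measure ℝ} {u : ℝ → State n} (hu : MemLp u 2 μ) (i : Fin n) :
    MemLp (fun z => u z i) 2 μ :=
  (EuclideanSpace.proj (𝕜 := ℝ) i : State n →L[ℝ] ℝ).comp_memLp' hu

lemma integral_component {n : ℕ} {μ : Measure ℝ} {u : ℝ → State n} (hu : Integrable u μ)
    (i : Fin n) : (∫ z, u z ∂μ) i = ∫ z, u z i ∂μ :=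
  ((EuclideanSpace.proj (𝕜 := ℝ) i : State n →L[ℝ] ℝ).integral_comp_comm hu).symm

lemma HasWeakDeriv.component {n : ℕ} {u v : ℝ → State n}
    (hu : MemLp u 2 (volume.restrict xiInterval)) (hv : MemLp v 2 (volume.restrict xiInterval))
    (h : HasWeakDeriv u v) (i : Fin n) :
    HasScalarWeakDeriv (Real.sqrt 3) (fun z => u z i) (fun z => v z i) := by
  intro φ hφ hφc hφs
  have hsmul : ∀ (ψ : ℝ → ℝ) (w : ℝ → State n), Continuous ψ →
      MemLp w 2 (volume.restrict xiInterval) →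
      Integrable (fun z => ψ z • w z) (volume.restrict xiInterval) := fun ψ w hψ hw =>
    memLp_one_iff_integrable.1 (hw.smul (hψ.continuousOn.memLp_Icc))
  have h1 := congrArg (fun w : State n => w i) (h φ hφ hφc hφs)
  simp only [PiLp.neg_apply] at h1
  rw [integral_component (hsmul _ _ (hφ.continuous_deriv (by simp)) hu),
    integral_component (hsmul _ _ hφ.continuous hv)] at h1
  exact h1

lemma scalarGagliardoSq_component_le {n : ℕ} (θ : ℝ) (v : ℝ → State n) (i : Fin n) :
    scalarGagliardoSq (Real.sqrt 3) θ (fun z => v z i) ≤ gagliardoSq θ v := by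
  refine lintegral_mono fun x => lintegral_mono fun y => ?_
  gcongr
  rw [← ofReal_norm, ← ofReal_norm]
  exact ENNReal.ofReal_le_ofReal (PiLp.norm_apply_le (v x - v y) i)

/-- Descends from the derivative of order ⌊s⌋, whose rate is s - ⌊s⌋ (trivial for integer s, from
the Gagliardo seminorm otherwise). Each step down gains one order. -/
lemma MemSobolev.hasPolynomialRate {n : ℕ} {s : ℝ} (hs : 0 ≤ s) {u : ℝ → State n}
    (hu : MemSobolev s u) (i : Fin n) :
    HasPolynomialRate (Real.sqrt 3) s (fun z => u z i) := by
  obtain ⟨D, hD0, hDm, hDd, hDg⟩ := hu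
  have hfl : (⌊s⌋₊ : ℝ) ≤ s := Nat.floor_le hs
  have key : ∀ k ≤ ⌊s⌋₊,
      HasPolynomialRate (Real.sqrt 3) (s - (⌊s⌋₊ - k : ℕ)) (fun z => D (⌊s⌋₊ - k) z i) := by
    intro k
    induction k with
    | zero =>
      intro _
      have hm := MemLp.component (hDm _ le_rfl) i
      rcases eq_or_ne s ⌊s⌋₊ with h | h
      · have h0 : s - (⌊s⌋₊ - 0 : ℕ) = 0 := by rw [Nat.sub_zero, ← h, sub_self]
        rw [h0]
        exact .zero hm
      · exact .of_gagliardo sqrt_three_pos (sub_pos.2 (lt_of_le_of_ne hfl h.symm)) hm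
          ((scalarGagliardoSq_component_le _ _ i).trans_lt (hDg h))
    | succ k ih =>
      intro hk
      have h1 := ih (by omega)
      have hk1 : ⌊s⌋₊ - k = ⌊s⌋₊ - (k + 1) + 1 := by omega
      have hm := hDm (⌊s⌋₊ - k) (by omega)
      have hd := hDd (⌊s⌋₊ - (k + 1)) (by omega)
      rw [← hk1] at hd
      have hm' := hDm (⌊s⌋₊ - (k + 1)) (by omega)
      have hr : 0 ≤ s - (⌊s⌋₊ - k : ℕ) := by
        have : ((⌊s⌋₊ - k : ℕ) : ℝ) ≤ ⌊s⌋₊ := by exact_mod_cast Nat.sub_le _ _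
        linarith
      have h2 := HasPolynomialRate.of_weakDeriv sqrt_three_pos hr (MemLp.component hm' i)
        (MemLp.component hm i) (hd.component hm' hm i) h1
      rw [hk1] at h2
      push_cast at h2
      rwa [show s - (((⌊s⌋₊ - (k + 1) : ℕ) : ℝ) + 1) + 1 = s - (⌊s⌋₊ - (k + 1) : ℕ) by ring] at h2
  obtain ⟨K, hK, h⟩ := key ⌊s⌋₊ le_rfl
  rw [Nat.sub_self, Nat.cast_zero, sub_zero] at h
  refine ⟨K, hK, fun N => ?_⟩
  obtain ⟨p, hp, hpN⟩ := h N
  refine ⟨p, hp, le_trans (le_of_eq (eLpNorm_congr_ae ?_)) hpN⟩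
  have hD0' : D 0 =ᵐ[symVol (Real.sqrt 3)] u := hD0
  filter_upwards [hD0'] with z hz
  rw [hz]

lemma polyCurve_continuous {n : ℕ} (p : Fin n → Polynomial ℝ) : Continuous (polyCurve p) :=
  (PiLp.continuous_toLp 2 _).comp (continuous_pi fun i => (p i).continuous)

lemma polyCurve_memLp {n : ℕ} (p : Fin n → Polynomial ℝ) :
    MemLp (polyCurve p) 2 (volume.restrict xiInterval) :=
  (polyCurve_continuous p).continuousOn.memLp_Icc

lemma polyCurve_sub {n : ℕ} (p q : Fin n → Polynomial ℝ) (z : ℝ) :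
    polyCurve (p - q) z = polyCurve p z - polyCurve q z := by
  ext i; simp [polyCurve]

lemma sub_mem_polySpace {n N : ℕ} {p q : Fin n → Polynomial ℝ} (hp : p ∈ polySpace n N)
    (hq : q ∈ polySpace n N) : p - q ∈ polySpace n N := fun i =>
  (Polynomial.natDegree_sub_le _ _).trans (max_le (hp i) (hq i))

lemma polySpace_mono {n N M : ℕ} (h : N ≤ M) : polySpace n N ⊆ polySpace n M :=
  fun _ hp i => (hp i).trans h

lemma l2Norm_eq {n : ℕ} {v : ℝ → State n} (hv : MemLp v 2 (volume.restrict xiInterval)) :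
    l2Norm v = (eLpNorm v 2 (volume.restrict xiInterval)).toReal := by
  rw [eLpNorm_two_eq hv, ENNReal.toReal_ofReal (Real.sqrt_nonneg _), l2Norm]

lemma l2Norm_nonneg {n : ℕ} (v : ℝ → State n) : 0 ≤ l2Norm v := Real.sqrt_nonneg _

lemma l2Norm_add_le {n : ℕ} {v w : ℝ → State n} (hv : MemLp v 2 (volume.restrict xiInterval))
    (hw : MemLp w 2 (volume.restrict xiInterval)) :
    l2Norm (fun z => v z + w z) ≤ l2Norm v + l2Norm w := by
  have h := hv.add hw
  change l2Norm (v + w) ≤ _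
  rw [l2Norm_eq hv, l2Norm_eq hw, l2Norm_eq h, ← ENNReal.toReal_add hv.2.ne hw.2.ne]
  exact ENNReal.toReal_mono (ENNReal.add_ne_top.2 ⟨hv.2.ne, hw.2.ne⟩)
    (eLpNorm_add_le hv.1 hw.1 (by norm_num))

lemma l2Norm_sub_comm {n : ℕ} (v w : ℝ → State n) :
    l2Norm (fun z => v z - w z) = l2Norm (fun z => w z - v z) := by
  simp only [l2Norm, norm_sub_rev]

lemma l2Norm_sub_le {n : ℕ} {u v w : ℝ → State n} (hu : MemLp u 2 (volume.restrict xiInterval))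
    (hv : MemLp v 2 (volume.restrict xiInterval)) (hw : MemLp w 2 (volume.restrict xiInterval)) :
    l2Norm (fun z => u z - w z) ≤ l2Norm (fun z => u z - v z) + l2Norm (fun z => v z - w z) := by
  have := l2Norm_add_le (hu.sub hv) (hv.sub hw)
  simp only [Pi.sub_apply, sub_add_sub_cancel] at this
  exact this

lemma l2Norm_mono {n : ℕ} {v w : ℝ → State n} (hv : MemLp v 2 (volume.restrict xiInterval))
    (hw : MemLp w 2 (volume.restrict xiInterval)) {c : ℝ} (hc : 0 ≤ c)
    (h : ∀ z ∈ xiInterval, ‖v z‖ ≤ c * ‖w z‖) : l2Norm v ≤ c * l2Norm w := by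
  rw [l2Norm_eq hv, l2Norm_eq hw, ← ENNReal.toReal_ofReal hc, ← ENNReal.toReal_mul]
  exact ENNReal.toReal_mono (ENNReal.mul_ne_top ENNReal.ofReal_ne_top hw.2.ne)
    (eLpNorm_le_mul_eLpNorm_of_ae_le_mul ((ae_restrict_mem measurableSet_Icc).mono h) 2)

theorem exists_polyCurve_rate {n : ℕ} {s : ℝ} (hs : 0 ≤ s) {u : ℝ → State n}
    (hum : MemLp u 2 (volume.restrict xiInterval)) (hu : MemSobolev s u) :
    ∃ K, 0 ≤ K ∧ ∀ N : ℕ, ∃ p ∈ polySpace n N,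
      l2Norm (fun z => u z - polyCurve p z) ≤ K * ((N : ℝ) + 1) ^ (-s) := by
  choose K hK h using fun i => hu.hasPolynomialRate hs i
  refine ⟨∑ i, K i, Finset.sum_nonneg fun i _ => hK i, fun N => ?_⟩
  choose p hp hpN using fun i => h i N
  refine ⟨p, hp, ?_⟩
  have hm := hum.sub (polyCurve_memLp p)
  have hsum : (u - polyCurve p) =
      ∑ i, fun z => (u z i - (p i).eval z) • EuclideanSpace.single i (1 : ℝ) := by
    ext z j
    simp [Finset.sum_apply, polyCurve, Pi.single_apply]
  have hci : ∀ i, MemLp (fun z => u z i - (p i).eval z) 2 (symVol (Real.sqrt 3)) :=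
    fun i => (MemLp.component hum i).sub_polynomial (p i)
  have hle : eLpNorm (u - polyCurve p) 2 (symVol (Real.sqrt 3)) ≤
      ENNReal.ofReal ((∑ i, K i) * ((N : ℝ) + 1) ^ (-s)) := by
    rw [hsum, Finset.sum_mul, ENNReal.ofReal_sum_of_nonneg fun i _ =>
      mul_nonneg (hK i) (by positivity)]
    refine (eLpNorm_sum_le (fun i _ => (hci i).1.smul_const _) (by norm_num)).trans
      (Finset.sum_le_sum fun i _ => ?_)
    refine le_trans (eLpNorm_mono fun z => ?_) (hpN i)
    simp [norm_smul]
  change l2Norm (u - polyCurve p) ≤ _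
  rw [l2Norm_eq hm]
  exact ENNReal.toReal_le_of_le_ofReal
    (mul_nonneg (Finset.sum_nonneg fun i _ => hK i) (by positivity)) hle

/-- The inverse inequality for polynomial curves. -/
theorem exists_norm_polyCurve_le (n : ℕ) : ∃ K, 0 < K ∧ ∀ N : ℕ, ∀ p ∈ polySpace n N,
    ∀ z ∈ xiInterval, ‖polyCurve p z‖ ≤ K * ((N : ℝ) + 1) * l2Norm (polyCurve p) := by
  set c := 16 / (Real.pi * Real.sqrt 3) with hc
  have h3 := sqrt_three_pos
  have hc0 : 0 < c := by have := Real.pi_pos; positivity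
  refine ⟨Real.sqrt c, Real.sqrt_pos.2 hc0, fun N p hp z hz => ?_⟩
  have hN : (0 : ℝ) < N + 1 := by positivity
  have hI : ∑ i, ∫ y in (-Real.sqrt 3)..(Real.sqrt 3), (p i).eval y ^ 2 =
      ∫ y in xiInterval, ‖polyCurve p y‖ ^ 2 := by
    have : ∀ y, ‖polyCurve p y‖ ^ 2 = ∑ i, (p i).eval y ^ 2 := fun y => by
      simp [EuclideanSpace.norm_sq_eq, polyCurve]
    simp_rw [this]
    rw [integral_finsetSum]
    · exact Finset.sum_congr rfl fun i _ => (integral_symVol h3.le _).symm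
    · intro i _
      have : Continuous fun y => (p i).eval y ^ 2 := (p i).continuous.pow 2
      exact this.continuousOn.integrableOn_Icc
  have hsq : ‖polyCurve p z‖ ^ 2 ≤ c * ((N : ℝ) + 1) ^ 2 * l2Norm (polyCurve p) ^ 2 := by
    rw [l2Norm, Real.sq_sqrt (integral_nonneg fun _ => sq_nonneg _), ← hI, Finset.mul_sum,
      EuclideanSpace.norm_sq_eq]
    refine Finset.sum_le_sum fun i _ => ?_
    simpa [polyCurve] using eval_sq_le_integral_sq h3 (hp i) hz
  refine abs_le_of_sq_le_sq' ?_ (mul_nonneg (by positivity) (l2Norm_nonneg _)) |>.2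
  rw [mul_pow, mul_pow, Real.sq_sqrt hc0.le]
  exact hsq

lemma eq_of_eqOn_xiInterval {n : ℕ} {p q : Fin n → Polynomial ℝ}
    (h : ∀ z ∈ xiInterval, polyCurve p z = polyCurve q z) : p = q := by
  funext i
  refine Polynomial.eq_of_infinite_eval_eq _ _ ?_
  have h3 := sqrt_three_pos
  refine (Icc_infinite (show -Real.sqrt 3 < Real.sqrt 3 by linarith)).mono fun z hz => ?_
  have := congrArg (fun w : State n => w i) (h z hz)
  simpa [polyCurve] using this

/-! ### Strongly monotone equations on a ball of a subspace. -/

/-- A map that is strongly monotone and Lipschitz on a ball of a finite-dimensional subspace, and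
small at its centre, is orthogonal to the subspace at some point of the ball. -/
theorem exists_galerkin_of_strongly_monotone {H : Type*} [NormedAddCommGroup H]
    [InnerProductSpace ℝ H] [CompleteSpace H] (K : Submodule ℝ H) [FiniteDimensional ℝ K] (Φ : H → H) {c : H}
    (hc : c ∈ K) {r m L : ℝ} (hr : 0 ≤ r) (hm : 0 < m) (hmL : m ≤ L)
    (hlip : ∀ x ∈ K, ∀ y ∈ K, ‖x - c‖ ≤ r → ‖y - c‖ ≤ r → ‖Φ x - Φ y‖ ≤ L * ‖x - y‖)
    (hmono : ∀ x ∈ K, ∀ y ∈ K, ‖x - c‖ ≤ r → ‖y - c‖ ≤ r →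
      m * ‖x - y‖ ^ 2 ≤ inner ℝ (Φ x - Φ y) (x - y))
    (hΦc : ‖Φ c‖ ≤ m * r / 2) :
    ∃ x ∈ K, ‖x - c‖ ≤ r ∧ ∀ v ∈ K, inner ℝ (Φ x) v = 0 := by
  have hL : 0 < L := hm.trans_le hmL
  set P := K.starProjection
  -- This step size minimises 1 - 2τm + τ²L², the bound on the squared Lipschitz constant of x ↦ x -
  -- τPΦ(x); the minimum is 1 - q.
  set τ := m / L ^ 2 with hτ
  have hτ0 : 0 < τ := by positivity
  set q := m ^ 2 / L ^ 2 with hq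
  have hq1 : q ≤ 1 := by
    rw [hq, div_le_one (by positivity)]
    gcongr
  have hq0 : 0 < q := by positivity
  have hτm : τ * m = q := by rw [hτ, hq]; ring
  have hτL : τ ^ 2 * L ^ 2 = q := by rw [hτ, hq]; field_simp
  set k := Real.sqrt (1 - q) with hk
  have hk0 : 0 ≤ k := Real.sqrt_nonneg _
  have hk2 : k ^ 2 = 1 - q := Real.sq_sqrt (by linarith)
  -- Needed for the ball to be mapped to itself: the centre moves by at most τmr/2 = qr/2 ≤ (1 -
  -- k)r.
  have hkq : q / 2 ≤ 1 - k := by nlinarith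
  set T : H → H := fun x => x - τ • P (Φ x) with hT
  set S : Set H := (K : Set H) ∩ Metric.closedBall c r with hS
  have hPle : ∀ v, ‖P v‖ ≤ ‖v‖ := fun v => K.norm_starProjection_apply_le v
  have hcontr : ∀ x ∈ S, ∀ y ∈ S, ‖T x - T y‖ ≤ k * ‖x - y‖ := by
    intro x hx y hy
    have hxc := mem_closedBall_iff_norm.1 hx.2
    have hyc := mem_closedBall_iff_norm.1 hy.2
    have hd : x - y ∈ K := K.sub_mem hx.1 hy.1
    have hTT : T x - T y = (x - y) - τ • P (Φ x - Φ y) := by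
      rw [map_sub, smul_sub, ← sub_sub_sub_comm]
    have hin : inner ℝ (x - y) (P (Φ x - Φ y)) = inner ℝ (Φ x - Φ y) (x - y) := by
      rw [← K.inner_starProjection_left_eq_right, K.starProjection_eq_self_iff.2 hd,
        real_inner_comm]
    refine abs_le_of_sq_le_sq' ?_ (by positivity) |>.2
    rw [hTT, norm_sub_sq_real, inner_smul_right, hin, norm_smul, mul_pow, mul_pow, hk2,
      Real.norm_eq_abs, sq_abs]
    have h1 := hmono x hx.1 y hy.1 hxc hyc
    have h2 : ‖P (Φ x - Φ y)‖ ^ 2 ≤ L ^ 2 * ‖x - y‖ ^ 2 := by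
      rw [← mul_pow]
      gcongr
      exact (hPle _).trans (hlip x hx.1 y hy.1 hxc hyc)
    have h3 := mul_le_mul_of_nonneg_left h2 (sq_nonneg τ)
    have h4 := mul_le_mul_of_nonneg_left h1 hτ0.le
    rw [← mul_assoc, hτL] at h3
    rw [← mul_assoc, hτm] at h4
    linarith
  have hcS : c ∈ S := ⟨hc, Metric.mem_closedBall_self hr⟩
  have hmaps : MapsTo T S S := by
    intro x hx
    refine ⟨K.sub_mem hx.1 (K.smul_mem _ (K.starProjection_apply_mem _)), ?_⟩
    rw [mem_closedBall_iff_norm]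
    have h1 := hcontr x hx c hcS
    have h2 : ‖T c - c‖ ≤ τ * (m * r / 2) := by
      rw [hT]
      simp only [sub_sub_cancel_left, norm_neg, norm_smul, Real.norm_of_nonneg hτ0.le]
      gcongr
      exact (hPle _).trans hΦc
    have h3 : k * ‖x - c‖ ≤ k * r := by
      gcongr
      exact mem_closedBall_iff_norm.1 hx.2
    have h4 : τ * (m * r / 2) = q / 2 * r := by rw [← hτm]; ring
    have h5 : q / 2 * r ≤ (1 - k) * r := by gcongr
    calc ‖T x - c‖ ≤ ‖T x - T c‖ + ‖T c - c‖ := norm_sub_le_norm_sub_add_norm_sub _ _ _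
      _ ≤ r := by linarith
  have hcomplete : IsComplete S :=
    (K.closed_of_finiteDimensional.inter Metric.isClosed_closedBall).isComplete
  have hk1 : k < 1 := by linarith
  have hCW : ContractingWith ⟨k, hk0⟩ (hmaps.restrict T S S) := by
    refine ⟨hk1, LipschitzWith.of_dist_le_mul fun x y => ?_⟩
    rw [Subtype.dist_eq, Subtype.dist_eq, dist_eq_norm, dist_eq_norm]
    exact hcontr x x.2 y y.2
  obtain ⟨x, hx, hfix, -⟩ := hCW.exists_fixedPoint' hcomplete hmaps hcS (edist_ne_top _ _)
  refine ⟨x, hx.1, mem_closedBall_iff_norm.1 hx.2, fun v hv => ?_⟩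
  have hP0 : P (Φ x) = 0 := by
    have h : x - τ • P (Φ x) = x := hfix
    rw [sub_eq_self, smul_eq_zero] at h
    exact h.resolve_left hτ0.ne'
  have := K.inner_starProjection_left_eq_right (Φ x) v
  rw [K.starProjection_eq_self_iff.2 hv] at this
  rw [← this, show K.starProjection (Φ x) = 0 from hP0, inner_zero_left]

/-! ### The monotone tube around the branch. -/

lemma param_mem {a b : ℝ} (hab : a < b) {z : ℝ} (hz : z ∈ xiInterval) :
    param a b z ∈ Icc a b := by
  have h3 := sqrt_three_pos
  have hstd : 0 < paramStd a b := div_pos (by linarith) (by positivity)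
  have hs : paramStd a b * Real.sqrt 3 = (b - a) / 2 := by
    rw [paramStd]; field_simp
  have h1 := mul_le_mul_of_nonneg_left hz.1 hstd.le
  have h2 := mul_le_mul_of_nonneg_left hz.2 hstd.le
  rw [mul_neg, hs] at h1
  rw [hs] at h2
  constructor <;> rw [param, paramMean] <;> linarith

lemma continuous_param (a b : ℝ) : Continuous (param a b) := by
  unfold param; fun_prop

/-- On the tube of radius `δ` around the branch `u`, the function `f` is Lipschitz with constant `L`
and strongly monotone with constant `m` in its first argument. -/
def IsMonotoneTube {n : ℕ} (f : State n → ℝ → State n) (a b : ℝ) (u : ℝ → State n)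
    (δ m L : ℝ) : Prop :=
  ∀ z ∈ xiInterval, ∀ w₁ w₂ : State n, ‖w₁ - u z‖ ≤ δ → ‖w₂ - u z‖ ≤ δ →
    ‖f w₁ (param a b z) - f w₂ (param a b z)‖ ≤ L * ‖w₁ - w₂‖ ∧
    m * ‖w₁ - w₂‖ ^ 2 ≤ inner ℝ (f w₁ (param a b z) - f w₂ (param a b z)) (w₁ - w₂)

/-- Uniform continuity on a compact tube keeps the Jacobian within lam / 2 of its value on the
branch. The mean value inequality on the convex ball at fixed z transfers this to increments of f,
and half of the definiteness constant survives. -/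
theorem exists_isMonotoneTube {n : ℕ} {a b : ℝ} (hab : a < b) {f : State n → ℝ → State n}
    (hfd : ∀ μ ∈ Icc a b, Differentiable ℝ fun w => f w μ)
    (hfd' : ContinuousOn (fun x : State n × ℝ => jac f x.1 x.2) (univ ×ˢ Icc a b))
    {u : ℝ → State n} (hu : ContinuousOn u xiInterval) {lam : ℝ} (hlam : 0 < lam)
    (hdef : ∀ z ∈ xiInterval, ∀ w : State n,
      lam * ‖w‖ ^ 2 ≤ inner ℝ (jac f (u z) (param a b z) w) w) :
    ∃ δ > 0, ∃ L, lam / 2 ≤ L ∧ IsMonotoneTube f a b u δ (lam / 2) L := by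
  -- Offsets from the branch serve as coordinates, so that the tube becomes the compact product Q.
  set J : ℝ × State n → (State n →L[ℝ] State n) :=
    fun x => jac f (u x.1 + x.2) (param a b x.1) with hJ
  set Q : Set (ℝ × State n) := xiInterval ×ˢ Metric.closedBall 0 1 with hQ
  have hQc : IsCompact Q := isCompact_Icc.prod (isCompact_closedBall 0 1)
  have hJc : ContinuousOn J Q := by
    have h1 : ContinuousOn (fun x : ℝ × State n => (u x.1 + x.2, param a b x.1)) Q :=
      ((hu.comp continuousOn_fst fun x hx => hx.1).add continuousOn_snd).prodMk
        ((continuous_param a b).comp_continuousOn continuousOn_fst)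
    exact hfd'.comp h1 fun x hx => ⟨mem_univ _, param_mem hab hx.1⟩
  obtain ⟨M, hM⟩ := hQc.exists_bound_of_continuousOn hJc
  have huc := hQc.uniformContinuousOn_of_continuous hJc
  obtain ⟨δ, hδ, hJδ⟩ := Metric.uniformContinuousOn_iff.1 huc (lam / 2) (by positivity)
  refine ⟨min (δ / 2) 1, by positivity, |M| + lam / 2, by linarith [abs_nonneg M], ?_⟩
  intro z hz w₁ w₂ h₁ h₂
  set μ := param a b z with hμ
  set A := jac f (u z) μ with hA
  have hA0 : J (z, 0) = A := by simp [hJ, hA, hμ]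
  have hz0 : (z, (0 : State n)) ∈ Q := ⟨hz, by simp⟩
  have hAM : ‖A‖ ≤ |M| := by rw [← hA0]; exact (hM _ hz0).trans (le_abs_self M)
  have hbound : ∀ w ∈ Metric.closedBall (u z) (min (δ / 2) 1),
      ‖fderiv ℝ (fun w => f w μ) w - A‖ ≤ lam / 2 := by
    intro w hw
    rw [mem_closedBall_iff_norm] at hw
    have hzw : (z, w - u z) ∈ Q := ⟨hz, by
      rw [mem_closedBall_zero_iff]; exact hw.trans (min_le_right _ _)⟩
    have h := hJδ _ hzw _ hz0 (by
      rw [Prod.dist_eq, dist_self, dist_zero_right, max_lt_iff]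
      exact ⟨hδ, (hw.trans (min_le_left _ _)).trans_lt (by linarith)⟩)
    rw [hA0, dist_eq_norm, hJ] at h
    simp only [add_sub_cancel] at h
    exact h.le
  have hmv : ‖f w₁ μ - f w₂ μ - A (w₁ - w₂)‖ ≤ lam / 2 * ‖w₁ - w₂‖ :=
    (convex_closedBall (u z) _).norm_image_sub_le_of_norm_fderiv_le'
      (fun w _ => (hfd μ (param_mem hab hz)) w) hbound (mem_closedBall_iff_norm.2 h₂)
      (mem_closedBall_iff_norm.2 h₁)
  constructor
  · calc ‖f w₁ μ - f w₂ μ‖ = ‖A (w₁ - w₂) + (f w₁ μ - f w₂ μ - A (w₁ - w₂))‖ := by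
          rw [add_sub_cancel]
      _ ≤ |M| * ‖w₁ - w₂‖ + lam / 2 * ‖w₁ - w₂‖ :=
          (norm_add_le _ _).trans (add_le_add (A.le_of_opNorm_le hAM _) hmv)
      _ = _ := by ring
  · have h1 := hdef z hz (w₁ - w₂)
    have h2 := abs_le.1 (abs_real_inner_le_norm (f w₁ μ - f w₂ μ - A (w₁ - w₂)) (w₁ - w₂))
    have h3 := mul_le_mul_of_nonneg_right hmv (norm_nonneg (w₁ - w₂))
    rw [inner_sub_left] at h2
    nlinarith [h2.1]

/-! ### From L² rates to uniform rates. -/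

/-- The excess W of ‖u - P 0‖ over B is at most ‖u - P k‖ for every k, so its L² norm vanishes; by
continuity W is zero everywhere. -/
lemma norm_sub_le_of_tendsto_l2Norm {n : ℕ} {u : ℝ → State n} (hu : ContinuousOn u xiInterval)
    {P : ℕ → Fin n → Polynomial ℝ} {B : ℝ}
    (hB : ∀ k, ∀ z ∈ xiInterval, ‖polyCurve (P 0) z - polyCurve (P k) z‖ ≤ B)
    (hP : Tendsto (fun k => l2Norm fun z => u z - polyCurve (P k) z) atTop (𝓝 0)) :
    ∀ z ∈ xiInterval, ‖u z - polyCurve (P 0) z‖ ≤ B := by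
  have hc : ∀ k, ContinuousOn (fun z => u z - polyCurve (P k) z) xiInterval :=
    fun k => hu.sub (polyCurve_continuous _).continuousOn
  set W : ℝ → ℝ := fun z => max (‖u z - polyCurve (P 0) z‖ - B) 0 with hW
  have hWc : ContinuousOn W xiInterval := ((hc 0).norm.sub continuousOn_const).sup continuousOn_const
  have hWi : IntegrableOn (fun z => W z ^ 2) xiInterval := (hWc.pow 2).integrableOn_Icc
  have hle : ∀ k, ∫ z in xiInterval, W z ^ 2 ≤ (l2Norm fun z => u z - polyCurve (P k) z) ^ 2 := by
    intro k
    rw [l2Norm, Real.sq_sqrt (integral_nonneg fun _ => sq_nonneg _)]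
    refine setIntegral_mono_on hWi ((hc k).norm.pow 2).integrableOn_Icc measurableSet_Icc
      fun z hz => ?_
    have h1 := norm_sub_le_norm_sub_add_norm_sub (u z) (polyCurve (P k) z) (polyCurve (P 0) z)
    have h2 := hB k z hz
    rw [norm_sub_rev] at h2
    have h3 : W z ≤ ‖u z - polyCurve (P k) z‖ := max_le (by linarith) (norm_nonneg _)
    have h4 : 0 ≤ W z := le_max_right _ _
    gcongr
  have h0 : ∫ z in xiInterval, W z ^ 2 = 0 := by
    refine le_antisymm ?_ (integral_nonneg fun _ => sq_nonneg _)
    have := hP.pow 2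
    rw [zero_pow two_ne_zero] at this
    exact ge_of_tendsto' this hle
  have hae := (integral_eq_zero_iff_of_nonneg (fun z => sq_nonneg (W z)) hWi).1 h0
  have h3 := sqrt_three_pos
  have heq := Measure.eqOn_Icc_of_ae_eq volume (show -Real.sqrt 3 ≠ Real.sqrt 3 by linarith) hae
    (hWc.pow 2) continuousOn_const
  intro z hz
  have h4 : W z ^ 2 = 0 := heq hz
  have h5 : ‖u z - polyCurve (P 0) z‖ - B ≤ W z := le_max_left _ _
  rw [pow_eq_zero_iff two_ne_zero] at h4
  linarith

/-- Polynomial approximations of order `s > 1` in `L²` converge uniformly of order `s - 1`. -/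
theorem exists_uniform_rate {n : ℕ} {s : ℝ} (hs : 1 < s) {u : ℝ → State n}
    (hu : ContinuousOn u xiInterval) {p : ℕ → Fin n → Polynomial ℝ}
    (hp : ∀ N, p N ∈ polySpace n N) {K : ℝ}
    (hrate : ∀ N, l2Norm (fun z => u z - polyCurve (p N) z) ≤ K * ((N : ℝ) + 1) ^ (-s)) :
    ∃ K', ∀ N, ∀ z ∈ xiInterval,
      ‖u z - polyCurve (p N) z‖ ≤ K' * ((N : ℝ) + 1) ^ (1 - s) := by
  obtain ⟨C, hC, hinv⟩ := exists_norm_polyCurve_le n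
  have hum : MemLp u 2 (volume.restrict xiInterval) := hu.memLp_Icc
  have hK : 0 ≤ K := by
    have := (l2Norm_nonneg _).trans (hrate 0)
    simpa using this
  set q : ℝ := 2 ^ (1 - s) with hq
  have hq0 : 0 < q := by positivity
  have hq1 : q < 1 := Real.rpow_lt_one_of_one_lt_of_neg (by norm_num) (by linarith)
  refine ⟨4 * C * K * (1 - q)⁻¹, fun N => ?_⟩
  have hN : (0 : ℝ) < N + 1 := by positivity
  -- Dyadic degrees starting at d 0 = N; the shift by one makes d k + 1 exactly (N + 1)2^k.
  set d : ℕ → ℕ := fun k => (N + 1) * 2 ^ k - 1 with hd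
  have hdc : ∀ k, ((d k : ℕ) : ℝ) + 1 = ((N : ℝ) + 1) * 2 ^ k := by
    intro k
    have h1 : 1 ≤ (N + 1) * 2 ^ k := Nat.one_le_iff_ne_zero.2 (by positivity)
    rw [hd]
    simp only
    rw [Nat.cast_sub h1]
    push_cast
    ring
  have hd0 : d 0 = N := by simp [hd]
  have hdm : Monotone d := by
    refine monotone_nat_of_le_succ fun k => ?_
    have := hdc k
    have h2 := hdc (k + 1)
    have : ((d k : ℕ) : ℝ) ≤ d (k + 1) := by
      have : (0:ℝ) < 2 ^ k := by positivity
      rw [pow_succ] at h2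
      nlinarith
    exact_mod_cast this
  have hratek : ∀ k, l2Norm (fun z => u z - polyCurve (p (d k)) z) ≤
      K * ((N : ℝ) + 1) ^ (-s) * ((2 : ℝ) ^ k) ^ (-s) := by
    intro k
    have := hrate (d k)
    rwa [hdc, Real.mul_rpow hN.le (by positivity), ← mul_assoc] at this
  -- The inverse inequality costs a factor 2^k against the L² gain 2^(-ks), leaving the ratio q =
  -- 2^(1-s), which is below 1 because s > 1.
  have hstep : ∀ k, ∀ z ∈ xiInterval, ‖polyCurve (p (d k)) z - polyCurve (p (d (k + 1))) z‖ ≤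
      4 * C * K * ((N : ℝ) + 1) ^ (1 - s) * q ^ k := by
    intro k z hz
    have hmem : p (d k) - p (d (k + 1)) ∈ polySpace n (d (k + 1)) :=
      sub_mem_polySpace (polySpace_mono (hdm k.le_succ) (hp _)) (hp _)
    have h1 := hinv _ _ hmem z hz
    rw [polyCurve_sub, funext (polyCurve_sub (p (d k)) (p (d (k + 1))))] at h1
    have h2 := l2Norm_sub_le (polyCurve_memLp (p (d k))) hum (polyCurve_memLp (p (d (k + 1))))
    rw [l2Norm_sub_comm (polyCurve (p (d k))) u] at h2
    have h3 := hratek k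
    have h4 : l2Norm (fun z => u z - polyCurve (p (d (k + 1))) z) ≤
        K * ((N : ℝ) + 1) ^ (-s) * ((2 : ℝ) ^ k) ^ (-s) := by
      refine (hratek (k + 1)).trans (mul_le_mul_of_nonneg_left ?_ (by positivity))
      exact Real.rpow_le_rpow_of_nonpos (by positivity)
        (pow_le_pow_right₀ (by norm_num) k.le_succ) (by linarith)
    have h5 : ((2 : ℝ) ^ k) ^ (-s) * 2 ^ k = q ^ k := by
      have h2k : (0 : ℝ) < 2 ^ k := by positivity
      calc ((2 : ℝ) ^ k) ^ (-s) * 2 ^ k = ((2 : ℝ) ^ k) ^ (-s) * ((2 : ℝ) ^ k) ^ (1 : ℝ) := by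
            rw [Real.rpow_one]
        _ = ((2 : ℝ) ^ k) ^ (1 - s) := by rw [← Real.rpow_add h2k]; congr 1; ring
        _ = q ^ k := by
            rw [hq, ← Real.rpow_natCast 2 k, ← Real.rpow_mul (by norm_num), mul_comm,
              Real.rpow_mul (by norm_num), Real.rpow_natCast]
    have h6 : ((N : ℝ) + 1) ^ (-s) * ((N : ℝ) + 1) = ((N : ℝ) + 1) ^ (1 - s) := by
      rw [sub_eq_add_neg, add_comm (1 : ℝ), Real.rpow_add hN, Real.rpow_one]
    calc _ ≤ C * (((d (k + 1) : ℕ) : ℝ) + 1) * l2Norm (fun z =>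
          polyCurve (p (d k)) z - polyCurve (p (d (k + 1))) z) := h1
      _ ≤ C * (((d (k + 1) : ℕ) : ℝ) + 1) *
          (2 * (K * ((N : ℝ) + 1) ^ (-s) * ((2 : ℝ) ^ k) ^ (-s))) := by
          gcongr
          linarith
      _ = 4 * C * K * (((N : ℝ) + 1) ^ (-s) * ((N : ℝ) + 1)) *
          (((2 : ℝ) ^ k) ^ (-s) * 2 ^ k) := by
          rw [hdc, pow_succ]; ring
      _ = _ := by rw [h5, h6]
  have hsum : ∀ k, ∀ z ∈ xiInterval, ‖polyCurve (p (d 0)) z - polyCurve (p (d k)) z‖ ≤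
      4 * C * K * ((N : ℝ) + 1) ^ (1 - s) * ∑ j ∈ Finset.range k, q ^ j := by
    intro k z hz
    induction k with
    | zero => simp
    | succ k ih =>
      rw [Finset.sum_range_succ, mul_add]
      exact (norm_sub_le_norm_sub_add_norm_sub _ (polyCurve (p (d k)) z) _).trans
        (add_le_add ih (hstep k z hz))
  have hgeom : ∀ k, ∑ j ∈ Finset.range k, q ^ j ≤ (1 - q)⁻¹ := by
    intro k
    rw [← tsum_geometric_of_lt_one hq0.le hq1]
    exact (summable_geometric_of_lt_one hq0.le hq1).sum_le_tsum _ fun j _ => by positivity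
  have hlim : Tendsto (fun k => l2Norm fun z => u z - polyCurve (p (d k)) z) atTop (𝓝 0) := by
    have h1 : Tendsto (fun k : ℕ => K * ((N : ℝ) + 1) ^ (-s) * ((2 : ℝ) ^ k) ^ (-s)) atTop
        (𝓝 (K * ((N : ℝ) + 1) ^ (-s) * 0)) :=
      ((tendsto_rpow_neg_atTop (by linarith)).comp
        (tendsto_pow_atTop_atTop_of_one_lt (by norm_num))).const_mul _
    rw [mul_zero] at h1
    exact squeeze_zero (fun k => l2Norm_nonneg _) hratek h1
  have := norm_sub_le_of_tendsto_l2Norm hu (P := fun k => p (d k))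
    (B := 4 * C * K * (1 - q)⁻¹ * ((N : ℝ) + 1) ^ (1 - s)) (fun k z hz => by
      refine (hsum k z hz).trans ?_
      calc _ ≤ 4 * C * K * ((N : ℝ) + 1) ^ (1 - s) * (1 - q)⁻¹ := by
            gcongr
            exact hgeom k
        _ = _ := by ring) hlim
  simpa only [hd0] using this

/-! ### Galerkin solutions inside the tube. -/

section

variable {n : ℕ} {f : State n → ℝ → State n} {a b : ℝ}

/-- The residual `z ↦ f (p z) (mean + std * z)` of a curve `p`. -/
noncomputable def residual (f : State n → ℝ → State n) (a b : ℝ) (p : ℝ → State n) (z : ℝ) : State n :=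
  f (p z) (param a b z)

lemma residual_memLp (hab : a < b)
    (hf : ContinuousOn (fun x : State n × ℝ => f x.1 x.2) (univ ×ˢ Icc a b))
    {p : ℝ → State n} (hp : ContinuousOn p xiInterval) :
    MemLp (residual f a b p) 2 (volume.restrict xiInterval) := by
  have h : ContinuousOn (fun z => (p z, param a b z)) xiInterval :=
    hp.prodMk (continuous_param a b).continuousOn
  have h2 : ContinuousOn (residual f a b p) xiInterval :=
    hf.comp h fun z hz => ⟨mem_univ _, param_mem hab hz⟩
  exact h2.memLp_Icc

lemma integral_inner_eq_inner_toLp {u v : ℝ → State n}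
    (hu : MemLp u 2 (volume.restrict xiInterval)) (hv : MemLp v 2 (volume.restrict xiInterval)) :
    ∫ z in xiInterval, inner ℝ (u z) (v z) = inner ℝ (hu.toLp u) (hv.toLp v) := by
  rw [L2.inner_def]
  refine integral_congr_ae ?_
  filter_upwards [hu.coeFn_toLp, hv.coeFn_toLp] with z h1 h2
  rw [h1, h2]

lemma norm_toLp_eq_l2Norm {u : ℝ → State n} (hu : MemLp u 2 (volume.restrict xiInterval)) :
    ‖hu.toLp u‖ = l2Norm u := by
  rw [Lp.norm_toLp, l2Norm_eq hu]

lemma integrable_inner {u v : ℝ → State n}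
    (hu : MemLp u 2 (volume.restrict xiInterval)) (hv : MemLp v 2 (volume.restrict xiInterval)) :
    Integrable (fun z => inner ℝ (u z) (v z)) (volume.restrict xiInterval) := by
  refine (L2.integrable_inner (𝕜 := ℝ) (hu.toLp u) (hv.toLp v)).congr ?_
  filter_upwards [hu.coeFn_toLp, hv.coeFn_toLp] with z h1 h2
  rw [h1, h2]

lemma abs_integral_inner_le {u v : ℝ → State n}
    (hu : MemLp u 2 (volume.restrict xiInterval)) (hv : MemLp v 2 (volume.restrict xiInterval)) :
    |∫ z in xiInterval, inner ℝ (u z) (v z)| ≤ l2Norm u * l2Norm v := by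
  rw [integral_inner_eq_inner_toLp hu hv, ← norm_toLp_eq_l2Norm hu, ← norm_toLp_eq_l2Norm hv]
  exact abs_real_inner_le_norm _ _

lemma IsMonotoneTube.le_integral_inner (hab : a < b)
    (hf : ContinuousOn (fun x : State n × ℝ => f x.1 x.2) (univ ×ˢ Icc a b))
    {u : ℝ → State n} {δ m L : ℝ} (htube : IsMonotoneTube f a b u δ m L)
    {p q : ℝ → State n} (hp : ContinuousOn p xiInterval) (hq : ContinuousOn q xiInterval)
    (hpu : ∀ z ∈ xiInterval, ‖p z - u z‖ ≤ δ) (hqu : ∀ z ∈ xiInterval, ‖q z - u z‖ ≤ δ) :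
    m * l2Norm (fun z => p z - q z) ^ 2 ≤
      ∫ z in xiInterval, inner ℝ (residual f a b p z - residual f a b q z) (p z - q z) := by
  rw [l2Norm, Real.sq_sqrt (integral_nonneg fun _ => sq_nonneg _), ← integral_const_mul]
  exact setIntegral_mono_on (((hp.sub hq).norm.pow 2).integrableOn_Icc.const_mul m)
    (integrable_inner ((residual_memLp hab hf hp).sub (residual_memLp hab hf hq))
      (hp.sub hq).memLp_Icc) measurableSet_Icc
    fun z hz => (htube z hz _ _ (hpu z hz) (hqu z hz)).2

lemma IsMonotoneTube.l2Norm_residual_sub_le (hab : a < b)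
    (hf : ContinuousOn (fun x : State n × ℝ => f x.1 x.2) (univ ×ˢ Icc a b))
    {u : ℝ → State n} {δ m L : ℝ} (hL : 0 ≤ L) (htube : IsMonotoneTube f a b u δ m L)
    {p q : ℝ → State n} (hp : ContinuousOn p xiInterval) (hq : ContinuousOn q xiInterval)
    (hpu : ∀ z ∈ xiInterval, ‖p z - u z‖ ≤ δ) (hqu : ∀ z ∈ xiInterval, ‖q z - u z‖ ≤ δ) :
    l2Norm (fun z => residual f a b p z - residual f a b q z) ≤
      L * l2Norm (fun z => p z - q z) :=
  l2Norm_mono ((residual_memLp hab hf hp).sub (residual_memLp hab hf hq)) (hp.sub hq).memLp_Icc hL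
    fun z hz => (htube z hz _ _ (hpu z hz) (hqu z hz)).1

lemma IsMonotoneTube.l2Norm_residual_le (hab : a < b)
    (hf : ContinuousOn (fun x : State n × ℝ => f x.1 x.2) (univ ×ˢ Icc a b))
    {u : ℝ → State n} {δ m L : ℝ} (hδ : 0 ≤ δ) (hL : 0 ≤ L) (htube : IsMonotoneTube f a b u δ m L)
    (hu : ContinuousOn u xiInterval) (hu0 : ∀ z ∈ xiInterval, f (u z) (param a b z) = 0)
    {q : ℝ → State n} (hq : ContinuousOn q xiInterval)
    (hqu : ∀ z ∈ xiInterval, ‖q z - u z‖ ≤ δ) :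
    l2Norm (residual f a b q) ≤ L * l2Norm (fun z => u z - q z) := by
  rw [l2Norm_sub_comm]
  refine l2Norm_mono (residual_memLp hab hf hq) (hq.sub hu).memLp_Icc hL fun z hz => ?_
  have := (htube z hz (q z) (u z) (hqu z hz) (by simpa using hδ)).1
  rwa [hu0 z hz, sub_zero] at this

/-- Quasi-optimality of Galerkin solutions in the tube. -/
lemma IsGalerkinSolution.l2Norm_sub_le (hab : a < b)
    (hf : ContinuousOn (fun x : State n × ℝ => f x.1 x.2) (univ ×ˢ Icc a b))
    {u : ℝ → State n} {δ m L : ℝ} (hδ : 0 ≤ δ) (hm : 0 < m) (hL : 0 ≤ L)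
    (htube : IsMonotoneTube f a b u δ m L)
    (hu : ContinuousOn u xiInterval) (hu0 : ∀ z ∈ xiInterval, f (u z) (param a b z) = 0)
    {N : ℕ} {p q : Fin n → Polynomial ℝ} (hp : IsGalerkinSolution f a b N p)
    (hq : q ∈ polySpace n N) (hpu : ∀ z ∈ xiInterval, ‖polyCurve p z - u z‖ ≤ δ)
    (hqu : ∀ z ∈ xiInterval, ‖polyCurve q z - u z‖ ≤ δ) :
    l2Norm (fun z => polyCurve p z - polyCurve q z) ≤
      L / m * l2Norm (fun z => u z - polyCurve q z) := by
  have hpc := (polyCurve_continuous p).continuousOn (s := xiInterval)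
  have hqc := (polyCurve_continuous q).continuousOn (s := xiInterval)
  set d := l2Norm (fun z => polyCurve p z - polyCurve q z) with hd
  have hd0 : 0 ≤ d := l2Norm_nonneg _
  have hdm : MemLp (fun z => polyCurve p z - polyCurve q z) 2 (volume.restrict xiInterval) :=
    (hpc.sub hqc).memLp_Icc
  have hrp := residual_memLp hab hf hpc
  have hrq := residual_memLp hab hf hqc
  have h1 := htube.le_integral_inner hab hf hpc hqc hpu hqu
  -- Galerkin orthogonality, tested with p - q; only the residual of q remains in the monotonicity
  -- estimate.
  have h2 : ∫ z in xiInterval, inner ℝ (residual f a b (polyCurve p) z)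
      (polyCurve p z - polyCurve q z) = 0 := by
    have := hp.2 (p - q) (sub_mem_polySpace hp.1 hq)
    simp only [polyCurve_sub] at this
    exact this
  simp_rw [inner_sub_left] at h1
  rw [integral_sub (integrable_inner hrp hdm) (integrable_inner hrq hdm), h2, zero_sub] at h1
  have h3 := (neg_le_abs _).trans (abs_integral_inner_le hrq hdm)
  have h4 := htube.l2Norm_residual_le hab hf hδ hL hu hu0 hqc hqu
  have h5 : m * d ^ 2 ≤ L * l2Norm (fun z => u z - polyCurve q z) * d :=
    h1.trans (h3.trans (mul_le_mul_of_nonneg_right h4 hd0))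
  rw [div_mul_eq_mul_div, le_div_iff₀ hm]
  rcases hd0.eq_or_lt with h | h
  · rw [← h, zero_mul]; exact mul_nonneg hL (l2Norm_nonneg _)
  · nlinarith

/-- Both residuals are orthogonal to p - q, so strong monotonicity forces the L² distance to vanish;
the inverse inequality makes this pointwise. -/
lemma IsGalerkinSolution.eq_of_tube (hab : a < b)
    (hf : ContinuousOn (fun x : State n × ℝ => f x.1 x.2) (univ ×ˢ Icc a b))
    {u : ℝ → State n} {δ m L : ℝ} (hm : 0 < m) (htube : IsMonotoneTube f a b u δ m L)
    {N : ℕ} {p q : Fin n → Polynomial ℝ} (hp : IsGalerkinSolution f a b N p)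
    (hq : IsGalerkinSolution f a b N q) (hpu : ∀ z ∈ xiInterval, ‖polyCurve p z - u z‖ ≤ δ)
    (hqu : ∀ z ∈ xiInterval, ‖polyCurve q z - u z‖ ≤ δ) : p = q := by
  have hpc := (polyCurve_continuous p).continuousOn (s := xiInterval)
  have hqc := (polyCurve_continuous q).continuousOn (s := xiInterval)
  have hdm : MemLp (fun z => polyCurve p z - polyCurve q z) 2 (volume.restrict xiInterval) :=
    (hpc.sub hqc).memLp_Icc
  have hmem := sub_mem_polySpace hp.1 hq.1
  have h1 := htube.le_integral_inner hab hf hpc hqc hpu hqu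
  have h2 := hp.2 (p - q) hmem
  have h3 := hq.2 (p - q) hmem
  simp only [polyCurve_sub] at h2 h3
  simp_rw [inner_sub_left] at h1
  rw [integral_sub (integrable_inner (residual_memLp hab hf hpc) hdm)
    (integrable_inner (residual_memLp hab hf hqc) hdm)] at h1
  simp only [residual] at h1
  rw [h2, h3, sub_zero] at h1
  have h0 : l2Norm (fun z => polyCurve p z - polyCurve q z) = 0 := by
    by_contra hne
    have : 0 < m * l2Norm (fun z => polyCurve p z - polyCurve q z) ^ 2 := by
      have := (l2Norm_nonneg (fun z => polyCurve p z - polyCurve q z)).lt_of_ne' hne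
      positivity
    linarith
  obtain ⟨C, -, hinv⟩ := exists_norm_polyCurve_le n
  refine eq_of_eqOn_xiInterval fun z hz => ?_
  have h4 := hinv N _ hmem z hz
  rw [funext (polyCurve_sub p q), h0, mul_zero] at h4
  exact sub_eq_zero.1 (norm_le_zero_iff.1 h4)

/-- The polynomial curve with given coefficients. -/
noncomputable def coeffCurve (n N : ℕ) (c : Fin n → Fin (N + 1) → ℝ) : Fin n → Polynomial ℝ :=
  fun i => ∑ j : Fin (N + 1), Polynomial.monomial (j : ℕ) (c i j)

lemma coeffCurve_mem {N : ℕ} (c : Fin n → Fin (N + 1) → ℝ) : coeffCurve n N c ∈ polySpace n N :=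
  fun _ => Polynomial.natDegree_sum_le_of_forall_le _ _ fun j _ =>
    (Polynomial.natDegree_monomial_le _).trans (Nat.lt_succ_iff.1 j.2)

lemma exists_coeffCurve_eq {N : ℕ} {p : Fin n → Polynomial ℝ} (hp : p ∈ polySpace n N) :
    ∃ c, coeffCurve n N c = p := by
  refine ⟨fun i j => (p i).coeff j, funext fun i => ?_⟩
  rw [coeffCurve, Fin.sum_univ_eq_sum_range (fun j => Polynomial.monomial j ((p i).coeff j))]
  exact ((p i).as_sum_range' (N + 1) (Nat.lt_succ_of_le (hp i))).symm

/-- The `L²` class of a polynomial curve, as a linear map of its coefficients. -/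
noncomputable def curveLp (n N : ℕ) :
    (Fin n → Fin (N + 1) → ℝ) →ₗ[ℝ] Lp (State n) 2 (volume.restrict xiInterval) where
  toFun c := (polyCurve_memLp (coeffCurve n N c)).toLp _
  map_add' c d := by
    rw [← MemLp.toLp_add]
    congr 1
    ext z i
    simp [polyCurve, coeffCurve, Finset.sum_add_distrib, Polynomial.eval_finsetSum]
  map_smul' x c := by
    rw [RingHom.id_apply, ← MemLp.toLp_const_smul]
    congr 1
    ext z i
    simp [polyCurve, coeffCurve, Polynomial.eval_finsetSum, Finset.mul_sum, mul_assoc]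

/-- Transfers the equation to the finite-dimensional range of `curveLp` in L². The assumption
`hball` puts the L² ball inside the tube, and `hqr` makes the residual at its centre at most mr/2,
as `exists_galerkin_of_strongly_monotone` requires. -/
lemma exists_isGalerkinSolution (hab : a < b)
    (hf : ContinuousOn (fun x : State n × ℝ => f x.1 x.2) (univ ×ˢ Icc a b))
    {u : ℝ → State n} {δ m L : ℝ} (hδ : 0 ≤ δ) (hm : 0 < m) (hmL : m ≤ L)
    (htube : IsMonotoneTube f a b u δ m L)
    (hu : ContinuousOn u xiInterval) (hu0 : ∀ z ∈ xiInterval, f (u z) (param a b z) = 0)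
    {N : ℕ} {q : Fin n → Polynomial ℝ} (hq : q ∈ polySpace n N) {r : ℝ}
    (hqr : 2 * L / m * l2Norm (fun z => u z - polyCurve q z) ≤ r)
    (hball : ∀ p ∈ polySpace n N, l2Norm (fun z => polyCurve p z - polyCurve q z) ≤ r →
      ∀ z ∈ xiInterval, ‖polyCurve p z - u z‖ ≤ δ) :
    ∃ p, IsGalerkinSolution f a b N p ∧ l2Norm (fun z => polyCurve p z - polyCurve q z) ≤ r := by
  classical
  have hL : 0 < L := hm.trans_le hmL
  have hr : 0 ≤ r := le_trans (mul_nonneg (by positivity) (l2Norm_nonneg _)) hqr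
  set T := curveLp n N with hT
  have hTapp : ∀ c, T c = (polyCurve_memLp (coeffCurve n N c)).toLp _ := fun c => rfl
  have hcont : ∀ c, ContinuousOn (polyCurve (coeffCurve n N c)) xiInterval :=
    fun c => (polyCurve_continuous _).continuousOn
  have hdist : ∀ c d, ‖T c - T d‖ =
      l2Norm (fun z => polyCurve (coeffCurve n N c) z - polyCurve (coeffCurve n N d) z) := by
    intro c d
    rw [hTapp, hTapp, ← MemLp.toLp_sub, norm_toLp_eq_l2Norm]
    rfl
  set R : (Fin n → Fin (N + 1) → ℝ) → Lp (State n) 2 (volume.restrict xiInterval) :=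
    fun c => (residual_memLp hab hf (hcont c)).toLp _ with hR
  -- A section of T; values outside the range are irrelevant, since all conditions on Φ concern
  -- points of the subspace.
  set coef : Lp (State n) 2 (volume.restrict xiInterval) → (Fin n → Fin (N + 1) → ℝ) :=
    Function.invFun T with hcoef
  have hcoefT : ∀ x ∈ LinearMap.range T, T (coef x) = x := fun x hx => Function.invFun_eq hx
  obtain ⟨c₀, hc₀⟩ := exists_coeffCurve_eq hq
  set Φ := fun x => R (coef x) with hΦ
  have hqT : ∀ x ∈ LinearMap.range T, ‖x - T c₀‖ =
      l2Norm (fun z => polyCurve (coeffCurve n N (coef x)) z - polyCurve q z) := by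
    intro x hx
    rw [← hc₀, ← hdist, hcoefT x hx]
  have htub : ∀ x ∈ LinearMap.range T, ‖x - T c₀‖ ≤ r →
      ∀ z ∈ xiInterval, ‖polyCurve (coeffCurve n N (coef x)) z - u z‖ ≤ δ := by
    intro x hx hxr
    rw [hqT x hx] at hxr
    exact hball _ (coeffCurve_mem _) hxr
  have hc₀mem : T c₀ ∈ LinearMap.range T := ⟨c₀, rfl⟩
  have hRsub : ∀ c d, R c - R d = ((residual_memLp hab hf (hcont c)).sub
      (residual_memLp hab hf (hcont d))).toLp _ := fun c d => (MemLp.toLp_sub _ _).symm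
  obtain ⟨x, hx, hxr, hx0⟩ := exists_galerkin_of_strongly_monotone (LinearMap.range T) Φ hc₀mem hr
    hm hmL
    (by
      intro x hx y hy hxr hyr
      rw [hΦ]
      simp only
      rw [hRsub, norm_toLp_eq_l2Norm, ← hcoefT x hx, ← hcoefT y hy, hdist, hcoefT x hx,
        hcoefT y hy]
      exact htube.l2Norm_residual_sub_le hab hf hL.le (hcont _) (hcont _) (htub x hx hxr)
        (htub y hy hyr))
    (by
      intro x hx y hy hxr hyr
      have h1 := htube.le_integral_inner hab hf (hcont _) (hcont _) (htub x hx hxr) (htub y hy hyr)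
      have h2 := integral_inner_eq_inner_toLp
        ((residual_memLp hab hf (hcont (coef x))).sub (residual_memLp hab hf (hcont (coef y))))
        ((polyCurve_memLp (coeffCurve n N (coef x))).sub
          (polyCurve_memLp (coeffCurve n N (coef y))))
      rw [← hRsub, MemLp.toLp_sub (polyCurve_memLp _) (polyCurve_memLp _), ← hTapp, ← hTapp,
        hcoefT x hx, hcoefT y hy] at h2
      rw [← hdist, hcoefT x hx, hcoefT y hy] at h1
      exact h1.trans_eq h2)
    (by
      have h1 : ‖Φ (T c₀)‖ = l2Norm (residual f a b (polyCurve (coeffCurve n N (coef (T c₀))))) :=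
        norm_toLp_eq_l2Norm _
      -- Rather than identify `coef (T c₀)` with c₀, it suffices that their curves have L² distance
      -- zero.
      have h2 := hqT _ hc₀mem
      rw [sub_self, norm_zero] at h2
      have h3 := htube.l2Norm_residual_le hab hf hδ hL.le hu hu0 (hcont (coef (T c₀)))
        (htub _ hc₀mem (by simpa using hr))
      have h4 := PCEGalerkin.l2Norm_sub_le hu.memLp_Icc (polyCurve_memLp q)
        (polyCurve_memLp (coeffCurve n N (coef (T c₀))))
      rw [l2Norm_sub_comm (polyCurve q), ← h2, add_zero] at h4
      rw [h1]
      refine h3.trans ((mul_le_mul_of_nonneg_left h4 hL.le).trans ?_)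
      calc L * l2Norm (fun z => u z - polyCurve q z)
          = m * (2 * L / m * l2Norm (fun z => u z - polyCurve q z)) / 2 := by field_simp
        _ ≤ m * r / 2 := by gcongr)
  refine ⟨coeffCurve n N (coef x), ⟨coeffCurve_mem _, fun v hv => ?_⟩, ?_⟩
  · obtain ⟨d, hd⟩ := exists_coeffCurve_eq hv
    have h1 := hx0 (T d) ⟨d, rfl⟩
    rw [← hd]
    refine Eq.trans ?_ h1
    exact integral_inner_eq_inner_toLp (residual_memLp hab hf (hcont (coef x)))
      (polyCurve_memLp (coeffCurve n N d))
  · rw [← hqT x hx]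
    exact hxr

end

/-! ### Rates for successive terms and the convergence theorem. -/

lemma tendsto_add_one_rpow_neg {r : ℝ} (hr : 0 < r) :
    Tendsto (fun N : ℕ => ((N : ℝ) + 1) ^ (-r)) atTop (𝓝 0) :=
  (tendsto_rpow_neg_atTop hr).comp
    (tendsto_atTop_add_const_right _ _ tendsto_natCast_atTop_atTop)

lemma successiveRate_of_le {n : ℕ} {s : ℝ} (hs : 0 ≤ s) {v : ℝ → State n}
    (hv : MemLp v 2 (volume.restrict xiInterval)) {u : ℕ → Fin n → Polynomial ℝ} {K : ℝ}
    (h : ∀ᶠ N : ℕ in atTop, l2Norm (fun z => polyCurve (u N) z - v z) ≤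
      K * ((N : ℝ) + 1) ^ (-s)) : SuccessiveRate s u := by
  obtain ⟨N₀, hN₀⟩ := eventually_atTop.1 h
  refine IsBigO.of_bound (2 * |K|) (eventually_atTop.2 ⟨max N₀ 1, fun N hN => ?_⟩)
  have hN1 : (1 : ℝ) ≤ N := by exact_mod_cast (le_max_right _ _).trans hN
  have hle : ∀ M : ℕ, N ≤ M →
      l2Norm (fun z => polyCurve (u M) z - v z) ≤ |K| * (N : ℝ) ^ (-s) := by
    intro M hM
    refine (hN₀ M ((le_max_left _ _).trans (hN.trans hM))).trans ?_
    refine mul_le_mul (le_abs_self K) ?_ (by positivity) (abs_nonneg K)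
    refine Real.rpow_le_rpow_of_nonpos (by linarith) ?_ (by linarith)
    have : (N : ℝ) ≤ M := by exact_mod_cast hM
    linarith
  rw [Real.norm_of_nonneg (l2Norm_nonneg _), Real.norm_of_nonneg (by positivity)]
  refine (l2Norm_sub_le (polyCurve_memLp _) hv (polyCurve_memLp _)).trans ?_
  rw [l2Norm_sub_comm v]
  linarith [hle N le_rfl, hle (N + 1) N.le_succ]

/-- The conclusion of the convergence theorem for Galerkin approximations. -/
def GalerkinConvergence {n : ℕ} (f : State n → ℝ → State n) (a b : ℝ) (ubar : ℝ → State n) (s : ℝ)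
    (uLS : ℕ → Fin n → Polynomial ℝ) : Prop :=
  (∃ ρ > (0 : ℝ), ∃ Nconv : ℕ,
    (∀ N ≥ Nconv, ∃! p : Fin n → Polynomial ℝ, IsGalerkinSolutionNear f a b N ρ (uLS N) p) ∧
    (∀ u : ℕ → Fin n → Polynomial ℝ,
      (∀ N ≥ Nconv, IsGalerkinSolutionNear f a b N ρ (uLS N) (u N)) →
        TendstoUniformlyOn (fun N => polyCurve (u N)) ubar atTop xiInterval ∧
        SuccessiveRate s u)) ∧
  (∀ u : ℕ → Fin n → Polynomial ℝ,
    (∀ᶠ N in atTop, IsGalerkinSolution f a b N (u N)) →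
    TendstoUniformlyOn (fun N => polyCurve (u N)) ubar atTop xiInterval →
    SuccessiveRate s u)

theorem galerkinConvergence_of_posDef {n : ℕ} {a b : ℝ} (hab : a < b)
    {f : State n → ℝ → State n}
    (hf : ContinuousOn (fun x : State n × ℝ => f x.1 x.2) (univ ×ˢ Icc a b))
    (hfd : ∀ μ ∈ Icc a b, Differentiable ℝ fun w => f w μ)
    (hfd' : ContinuousOn (fun x : State n × ℝ => jac f x.1 x.2) (univ ×ˢ Icc a b))
    {ubar : ℝ → State n} (hubar : ContinuousOn ubar xiInterval)
    (hbranch : ∀ z ∈ xiInterval, f (ubar z) (param a b z) = 0)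
    {s : ℝ} (hs : 1 < s) (hsob : MemSobolev s ubar) {lam : ℝ} (hlam : 0 < lam)
    (hdef : ∀ z ∈ xiInterval, ∀ w : State n,
      lam * ‖w‖ ^ 2 ≤ inner ℝ (jac f (ubar z) (param a b z) w) w)
    {uLS : ℕ → Fin n → Polynomial ℝ} (huLS : ∀ N, IsLeastSquares N ubar (uLS N)) :
    GalerkinConvergence f a b ubar s uLS := by
  have hs0 : 0 ≤ s := by linarith
  have hum : MemLp ubar 2 (volume.restrict xiInterval) := hubar.memLp_Icc
  obtain ⟨δ, hδ, L, hL, htube⟩ := exists_isMonotoneTube hab hfd hfd' hubar hlam hdef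
  set m := lam / 2 with hm
  have hm0 : 0 < m := by positivity
  have hL0 : 0 < L := hm0.trans_le hL
  obtain ⟨K, hK, happrox⟩ := exists_polyCurve_rate hs0 hum hsob
  have hrate : ∀ N, l2Norm (fun z => ubar z - polyCurve (uLS N) z) ≤ K * ((N : ℝ) + 1) ^ (-s) := by
    intro N
    obtain ⟨p, hp, hpN⟩ := happrox N
    exact ((huLS N).2 p hp).trans hpN
  have hmem : ∀ N, uLS N ∈ polySpace n N := fun N => (huLS N).1
  obtain ⟨K', hK'⟩ := exists_uniform_rate hs hubar hmem hrate
  obtain ⟨C, hC, hinv⟩ := exists_norm_polyCurve_le n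
  have hpow : ∀ N : ℕ, ((N : ℝ) + 1) * ((N : ℝ) + 1) ^ (-s) = ((N : ℝ) + 1) ^ (-(s - 1)) := by
    intro N
    have hN : (0 : ℝ) < N + 1 := by positivity
    rw [show -(s - 1) = 1 + -s by ring, Real.rpow_add hN, Real.rpow_one]
  have hpow' : ∀ N : ℕ, ((N : ℝ) + 1) ^ (1 - s) = ((N : ℝ) + 1) ^ (-(s - 1)) := fun N => by
    rw [neg_sub]
  have hsmall : ∀ c ε : ℝ, 0 < ε → ∀ᶠ N : ℕ in atTop, c * ((N : ℝ) + 1) ^ (-(s - 1)) < ε := by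
    intro c ε hε
    have := (tendsto_add_one_rpow_neg (r := s - 1) (by linarith)).const_mul c
    rw [mul_zero] at this
    exact this.eventually_lt_const hε
  have hLSunif : ∀ ε > 0, ∀ᶠ N : ℕ in atTop, ∀ z ∈ xiInterval,
      ‖polyCurve (uLS N) z - ubar z‖ < ε := by
    intro ε hε
    filter_upwards [hsmall K' ε hε] with N hN z hz
    rw [norm_sub_rev]
    refine (hK' N z hz).trans_lt ?_
    rwa [hpow']
  -- The radius demanded by `exists_isGalerkinSolution`, with the error replaced by its bound. It
  -- also exceeds the Céa bound, which has L / m instead of 2L / m.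
  set r : ℕ → ℝ := fun N => 2 * L / m * (K * ((N : ℝ) + 1) ^ (-s)) with hr
  -- The L² balls shrink uniformly: the factor N + 1 of the inverse inequality is beaten by (N +
  -- 1)^(-s).
  have hnear : ∀ ε > 0, ∀ᶠ N : ℕ in atTop, ∀ p ∈ polySpace n N,
      l2Norm (fun z => polyCurve p z - polyCurve (uLS N) z) ≤ r N →
      ∀ z ∈ xiInterval, ‖polyCurve p z - polyCurve (uLS N) z‖ < ε := by
    intro ε hε
    filter_upwards [hsmall (C * (2 * L / m * K)) ε hε] with N hN p hp hpr z hz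
    have h1 := hinv N _ (sub_mem_polySpace hp (hmem N)) z hz
    rw [funext (polyCurve_sub p (uLS N))] at h1
    refine h1.trans_lt (lt_of_le_of_lt (mul_le_mul_of_nonneg_left hpr (by positivity)) ?_)
    calc C * ((N : ℝ) + 1) * r N
        = C * (2 * L / m * K) * (((N : ℝ) + 1) * ((N : ℝ) + 1) ^ (-s)) := by rw [hr]; ring
      _ < ε := by rwa [hpow]
  have hcea : ∀ N, ∀ p, IsGalerkinSolution f a b N p →
      (∀ z ∈ xiInterval, ‖polyCurve p z - ubar z‖ ≤ δ) →
      (∀ z ∈ xiInterval, ‖polyCurve (uLS N) z - ubar z‖ ≤ δ) →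
      l2Norm (fun z => polyCurve p z - polyCurve (uLS N) z) ≤ r N := by
    intro N p hp hpu hqu
    refine (hp.l2Norm_sub_le hab hf hδ.le hm0 hL0.le htube hubar hbranch (hmem N) hpu hqu).trans ?_
    have h1 : L / m ≤ 2 * L / m := by gcongr; linarith
    exact mul_le_mul h1 (hrate N) (l2Norm_nonneg _) (by positivity)
  have hsucc : ∀ u : ℕ → Fin n → Polynomial ℝ,
      (∀ᶠ N in atTop, l2Norm (fun z => polyCurve (u N) z - polyCurve (uLS N) z) ≤ r N) →
      SuccessiveRate s u := by
    intro u hu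
    refine successiveRate_of_le hs0 hum (K := 2 * L / m * K + K) ?_
    filter_upwards [hu] with N hN
    refine (l2Norm_sub_le (polyCurve_memLp _) (polyCurve_memLp (uLS N)) hum).trans ?_
    rw [l2Norm_sub_comm (polyCurve (uLS N))]
    calc _ ≤ r N + K * ((N : ℝ) + 1) ^ (-s) := add_le_add hN (hrate N)
      _ = _ := by rw [hr]; ring
  obtain ⟨N₀, hN₀⟩ := eventually_atTop.1
    ((hLSunif (δ / 2) (by positivity)).and (hnear (δ / 2) (by positivity)))
  have htri : ∀ N ≥ N₀, ∀ p : Fin n → Polynomial ℝ,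
      (∀ z ∈ xiInterval, ‖polyCurve p z - polyCurve (uLS N) z‖ < δ / 2) →
      ∀ z ∈ xiInterval, ‖polyCurve p z - ubar z‖ ≤ δ := by
    intro N hN p hp z hz
    have h1 := norm_sub_le_norm_sub_add_norm_sub (polyCurve p z) (polyCurve (uLS N) z) (ubar z)
    linarith [hp z hz, (hN₀ N hN).1 z hz]
  have hLStube : ∀ N ≥ N₀, ∀ z ∈ xiInterval, ‖polyCurve (uLS N) z - ubar z‖ ≤ δ :=
    fun N hN z hz => by linarith [(hN₀ N hN).1 z hz]
  -- Half of the tube radius is ρ; the other half absorbs the distance from the least-squares curve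
  -- to the branch.
  refine ⟨⟨δ / 2, by positivity, N₀, fun N hN => ?_, fun u hu => ?_⟩, fun u hu hunif => ?_⟩
  · obtain ⟨p, hp, hpr⟩ := exists_isGalerkinSolution hab hf hδ.le hm0 hL htube hubar hbranch
      (hmem N) (r := r N) (mul_le_mul_of_nonneg_left (hrate N) (by positivity))
      (fun p hp hpr => htri N hN p ((hN₀ N hN).2 p hp hpr))
    refine ⟨p, ⟨hp, (hN₀ N hN).2 p hp.1 hpr⟩, fun q hq => ?_⟩
    exact hq.1.eq_of_tube hab hf hm0 htube hp (htri N hN q hq.2)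
      (htri N hN p ((hN₀ N hN).2 p hp.1 hpr))
  · have hur : ∀ᶠ N in atTop,
        l2Norm (fun z => polyCurve (u N) z - polyCurve (uLS N) z) ≤ r N :=
      eventually_atTop.2 ⟨N₀, fun N hN =>
        hcea N _ (hu N hN).1 (htri N hN _ (hu N hN).2) (hLStube N hN)⟩
    refine ⟨?_, hsucc u hur⟩
    rw [Metric.tendstoUniformlyOn_iff]
    intro ε hε
    filter_upwards [hur, hLSunif (ε / 2) (by positivity), hnear (ε / 2) (by positivity),
      eventually_ge_atTop N₀] with N h1 h2 h3 hN z hz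
    rw [dist_comm, dist_eq_norm]
    have h4 := norm_sub_le_norm_sub_add_norm_sub (polyCurve (u N) z) (polyCurve (uLS N) z) (ubar z)
    linarith [h2 z hz, h3 _ (hu N hN).1.1 h1 z hz]
  · refine hsucc u ?_
    filter_upwards [hu, Metric.tendstoUniformlyOn_iff.1 hunif δ hδ, eventually_ge_atTop N₀]
      with N h1 h2 hN
    refine hcea N _ h1 (fun z hz => ?_) (hLStube N hN)
    have := h2 z hz
    rw [dist_comm, dist_eq_norm] at this
    exact this.le

/-- An equality of predicates, so that it rewrites beneath the quantifiers of the convergence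
statement. -/
lemma isGalerkinSolution_neg {n : ℕ} (f : State n → ℝ → State n) (a b : ℝ) :
    IsGalerkinSolution (fun w μ => -f w μ) a b = IsGalerkinSolution f a b := by
  funext N p
  simp only [IsGalerkinSolution, inner_neg_left, integral_neg, neg_eq_zero]

lemma jac_neg {n : ℕ} (f : State n → ℝ → State n) (w : State n) (μ : ℝ) :
    jac (fun w μ => -f w μ) w μ = -jac f w μ := fderiv_fun_neg

end PCEGalerkin

theorem mainTheorem5 {n : ℕ} (a b : ℝ) (hab : a < b)
    (f : PCEGalerkin.State n → ℝ → PCEGalerkin.State n)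
    (hf : ContinuousOn (fun x : PCEGalerkin.State n × ℝ => f x.1 x.2) (univ ×ˢ Icc a b))
    (hfd : ∀ μ ∈ Icc a b, Differentiable ℝ fun w => f w μ)
    (hfd' : ContinuousOn (fun x : PCEGalerkin.State n × ℝ => PCEGalerkin.jac f x.1 x.2)
      (univ ×ˢ Icc a b))
    (ubar : ℝ → PCEGalerkin.State n) (hubar : ContinuousOn ubar PCEGalerkin.xiInterval)
    (hbranch : ∀ z ∈ PCEGalerkin.xiInterval, f (ubar z) (PCEGalerkin.param a b z) = 0)
    (s : ℝ) (hs : 1 < s) (hsob : PCEGalerkin.MemSobolev s ubar)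
    (lam : ℝ) (hlam : 0 < lam)
    (hdef :
      (∀ z ∈ PCEGalerkin.xiInterval, ∀ w : PCEGalerkin.State n,
        lam * ‖w‖ ^ 2 ≤ inner ℝ (PCEGalerkin.jac f (ubar z) (PCEGalerkin.param a b z) w) w) ∨
      (∀ z ∈ PCEGalerkin.xiInterval, ∀ w : PCEGalerkin.State n,
        inner ℝ (PCEGalerkin.jac f (ubar z) (PCEGalerkin.param a b z) w) w ≤ -(lam * ‖w‖ ^ 2)))
    (uLS : ℕ → Fin n → Polynomial ℝ)
    (huLS : ∀ N, PCEGalerkin.IsLeastSquares N ubar (uLS N)) :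
    (∃ ρ > (0 : ℝ), ∃ Nconv : ℕ,
      (∀ N ≥ Nconv, ∃! p : Fin n → Polynomial ℝ,
        PCEGalerkin.IsGalerkinSolutionNear f a b N ρ (uLS N) p) ∧
      (∀ u : ℕ → Fin n → Polynomial ℝ,
        (∀ N ≥ Nconv, PCEGalerkin.IsGalerkinSolutionNear f a b N ρ (uLS N) (u N)) →
          TendstoUniformlyOn (fun N => PCEGalerkin.polyCurve (u N)) ubar atTop
            PCEGalerkin.xiInterval ∧
          PCEGalerkin.SuccessiveRate s u)) ∧
    (∀ u : ℕ → Fin n → Polynomial ℝ,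
      (∀ᶠ N in atTop, PCEGalerkin.IsGalerkinSolution f a b N (u N)) →
      TendstoUniformlyOn (fun N => PCEGalerkin.polyCurve (u N)) ubar atTop
        PCEGalerkin.xiInterval →
      PCEGalerkin.SuccessiveRate s u) := by
  rcases hdef with hdef | hdef
  · exact PCEGalerkin.galerkinConvergence_of_posDef hab hf hfd hfd' hubar hbranch hs hsob hlam hdef
      huLS
  -- Changing the sign of f makes the Jacobian positive definite and leaves the branch and the
  -- Galerkin solutions unchanged.
  · have h := PCEGalerkin.galerkinConvergence_of_posDef (f := fun w μ => -f w μ) hab hf.neg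
      (fun μ hμ => (hfd μ hμ).neg)
      (hfd'.neg.congr fun x _ => PCEGalerkin.jac_neg f x.1 x.2) hubar
      (fun z hz => by rw [hbranch z hz, neg_zero]) hs hsob hlam
      (fun z hz w => by
        rw [PCEGalerkin.jac_neg, _root_.neg_apply, inner_neg_left]
        linarith [hdef z hz w]) huLS
    simp only [PCEGalerkin.GalerkinConvergence, PCEGalerkin.IsGalerkinSolutionNear,
      PCEGalerkin.isGalerkinSolution_neg] at h
    exact h
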